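/- Three players simultaneously and independently choose real numbers (guesses) in $[0,1]$, and a target $r$ is drawn uniformly from $[0,1]$. A winning guess is a largest one among the guesses that are smaller than $r$. If $k\ge 1$ players share the winning guess, each of them receives $3/k-1$ and every other player receives $-1$; if no guess is smaller than $r$, all players receive $0$. A mixed strategy is a probability measure on $[0,1]$, equivalently its cumulative distribution function; it is called optimal if a Nash equilibrium results when all three players use it, that is, if no player can increase his expected payoff by switching to another mixed strategy while his two opponents keep using it. There is an optimal strategy concentrated on $[0,7/9]$ whose cumulative distribution function $F$ satisfies $F(0)=0$, $F(7/9)=1$ and is given on $[0,7/9]$ by a convergent power series $F(x)=\sum_{k\ge 0}c_kx^k$, $c_0=0$, which is approximately $$0.726193x+0.480269x^2+0.181628x^3+0.0444137x^4+0.0509559x^5+0.0648413x^6+0.0363864x^7+0.0123602x^8+0.0178371x^9+0.0244243x^{10}+0.0144697x^{11}+0.00535718x^{12}+\cdots;$$ precisely, the displayed coefficients differ from $c_k$ by at most $2\cdot10^{-6}$ for $k=1,2,3$, by at most $3\cdot10^{-7}$ for $4\le k\le 11$, and by at most $10^{-7}$ for $k=12$. Moreover, a player who guesses any fixed $x\in[0,7/9]$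 against two opponents who both use $F$ has expected payoff $0$, and on $(0,7/9)$ the function $F$ satisfies $$8F'^2-2FF'^2-6F'^3+6xF'^3-2F''-2FF''+F^2F''=0.$$ -/

import Mathlib

open MeasureTheory ProbabilityTheory

namespace PriceIsRight

open Classical in
/-- The players with a winning guess when the target is `r`: those whose guess is smaller than `r`
and is largest among all the guesses smaller than `r`. -/
noncomputable def winners {n : ℕ} (x : Fin n → ℝ) (r : ℝ) : Finset (Fin n) :=
  Finset.univ.filter fun i => x i < r ∧ ∀ j, x j < r → x j ≤ x i

open Classical in
/-- The payoff to player `i` when the guesses are `x` and the target is `r`: nothing if no guess is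
smaller than `r`; otherwise each of the `k` winners receives `n / k - 1` and everyone else `-1`. -/
noncomputable def targetPayoff {n : ℕ} (x : Fin n → ℝ) (r : ℝ) (i : Fin n) : ℝ :=
  if winners x r = ∅ then 0
  else if i ∈ winners x r then (n : ℝ) / ((winners x r).card : ℝ) - 1
  else -1

/-- The expected payoff `A_i(x)` to player `i`, the target being uniform in `[0,1]`. -/
noncomputable def payoff {n : ℕ} (x : Fin n → ℝ) (i : Fin n) : ℝ :=
  ∫ r in Set.Icc (0 : ℝ) 1, targetPayoff x r i

/-- A mixed strategy: a probability measure on the line concentrated on `[0,1]`. -/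
def IsMixedStrategy (μ : Measure ℝ) : Prop :=
  IsProbabilityMeasure μ ∧ μ (Set.Icc (0 : ℝ) 1)ᶜ = 0

/-- The expected payoff to player `i` when each player `j` guesses independently according to
`σ j`. -/
noncomputable def expectedPayoff {n : ℕ} (σ : Fin n → Measure ℝ) (i : Fin n) : ℝ :=
  ∫ x, payoff x i ∂(Measure.pi σ)

/-- `μ` is an optimal strategy of the `n`-person game: a Nash equilibrium results when each player
employs `μ`, i.e. if all the opponents of player `i` use `μ`, then no mixed strategy gives player
`i` a larger expected payoff than `μ`. -/
def IsOptimal (n : ℕ) (μ : Measure ℝ) : Prop :=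
  IsMixedStrategy μ ∧
    ∀ (i : Fin n) (ν : Measure ℝ), IsMixedStrategy ν →
      expectedPayoff (Function.update (fun _ : Fin n => μ) i ν) i ≤
        expectedPayoff (fun _ : Fin n => μ) i

end PriceIsRight

/-! Suppose both opponents use a continuous distribution function F. Ties then have probability
zero, and the guess x earns 3 ∫_x^1 (1 - F(r) + F(x))² dr - 1 + ∫_0^x (1 - F(r))² dr. Put T(x) =
∫_x^1 (1 - F(r) + F(x)) dr and u = 1 - F(x). The derivative of the payoff vanishes exactly when 6 F'
T = 3 - u². Since T' = F' (1 - x) - 1, differentiating this relation once more gives the stated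
second-order equation.

That equation is nonlinear in F but linear for the inverse function: y = 1 - x, as a function of u,
satisfies (3 - u²) y'' - (6 + 2u) y' + 6 y = 0. At the right endpoint, where u = 0 and T = y, the
relation 6 F' T = 3 says y'(0) = 2 y(0). So y is a multiple of the solution φ with φ(0) = 1, φ'(0) =
2. The multiplier (1 - u)(2 - u) makes the equation exact, and the resulting first integral
(`phi_first_integral`) gives φ(1) = 9/2. The condition F(0) = 0, i.e. y(1) = 1, then forces y =
2φ/9, and F reaches 1 at x = 1 - 2/9 = 7/9. Hence F is defined by φ(1 - F(x)) = 9/2 (1 - x).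

The analytic difficulty is that one Taylor series at 0 must represent F up to 7/9. This needs a
holomorphic inverse of φ on a disc about 9/2 of radius larger than 7/2. On a convex trapezoid, Re φ'
> 0 makes φ injective, and |φ - 9/2| ≥ 88/25 on the frontier makes its image cover the disc of
radius 88/25 (`exists_holomorphic_rightInverse`). Both inequalities are checked on the frontier by
exact integer arithmetic with Lipschitz bounds (`frontier_bounds`); the first passes to the interior
by the maximum principle (`re_phi'_pos`).

For the equilibrium, the payoff is constant on [0, 7/9] (`guessPayoff_eq_right`), the constant is 0,
and beyond 7/9 the payoff falls with slope -3, so no deviation gains. For the numbers, c₁ = 9 / (2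
φ'(1)) is computed to 22 digits, and the differential equation makes the other coefficients
polynomials in c₁ (`coeff_polynomials`). -/

namespace PriceIsRight

/-! ### Absolutely convergent power series over ℝ or ℂ: algebra, differentiation, identity theorem.
-/

section PowerSeriesEvaluation

open PowerSeries

variable {𝕜 : Type*} [RCLike 𝕜]

/-- The power series `f` converges absolutely on the open disc of radius `R`. -/
def ConvergesOn (f : PowerSeries 𝕜) (R : ℝ) : Prop :=
  ∀ ρ : ℝ, 0 ≤ ρ → ρ < R → Summable fun k => ‖coeff k f‖ * ρ ^ k

/-- The sum of the power series `f` at the point `z`. -/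
noncomputable def evalAt (f : PowerSeries 𝕜) (z : 𝕜) : 𝕜 := ∑' k, coeff k f * z ^ k

namespace ConvergesOn

variable {f g : PowerSeries 𝕜} {R : ℝ} {z : 𝕜}

lemma summable_norm (hf : ConvergesOn f R) (hz : ‖z‖ < R) :
    Summable fun k => ‖coeff k f * z ^ k‖ := by
  simpa [norm_mul, norm_pow] using hf ‖z‖ (norm_nonneg _) hz

lemma hasSum (hf : ConvergesOn f R) (hz : ‖z‖ < R) :
    HasSum (fun k => coeff k f * z ^ k) (evalAt f z) :=
  (hf.summable_norm hz).of_norm.hasSum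

lemma add (hf : ConvergesOn f R) (hg : ConvergesOn g R) : ConvergesOn (f + g) R := by
  intro ρ h0 hρ
  refine Summable.of_nonneg_of_le (fun k => by positivity) (fun k => ?_)
    ((hf ρ h0 hρ).add (hg ρ h0 hρ))
  rw [map_add, ← add_mul]
  gcongr
  exact norm_add_le _ _

lemma evalAt_add (hf : ConvergesOn f R) (hg : ConvergesOn g R) (hz : ‖z‖ < R) :
    evalAt (f + g) z = evalAt f z + evalAt g z := by
  refine (((hf.hasSum hz).add (hg.hasSum hz)).congr_fun ?_).tsum_eq
  intro k
  simp [add_mul]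

lemma neg (hf : ConvergesOn f R) : ConvergesOn (-f) R := by
  intro ρ h0 hρ
  simpa using hf ρ h0 hρ

lemma sub (hf : ConvergesOn f R) (hg : ConvergesOn g R) : ConvergesOn (f - g) R := by
  rw [sub_eq_add_neg]
  exact hf.add hg.neg

lemma evalAt_sub (hf : ConvergesOn f R) (hg : ConvergesOn g R) (hz : ‖z‖ < R) :
    evalAt (f - g) z = evalAt f z - evalAt g z := by
  refine (((hf.hasSum hz).sub (hg.hasSum hz)).congr_fun ?_).tsum_eq
  intro k
  simp [sub_mul]

lemma mul (hf : ConvergesOn f R) (hg : ConvergesOn g R) : ConvergesOn (f * g) R := by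
  intro ρ h0 hρ
  have h1 : Summable fun k => ‖‖coeff k f‖ * ρ ^ k‖ := (hf ρ h0 hρ).norm
  have h2 : Summable fun k => ‖‖coeff k g‖ * ρ ^ k‖ := (hg ρ h0 hρ).norm
  refine Summable.of_nonneg_of_le (fun k => by positivity) (fun k => ?_)
    (summable_norm_sum_mul_antidiagonal_of_summable_norm h1 h2)
  rw [coeff_mul]
  refine le_trans ?_ (le_abs_self _)
  calc ‖∑ p ∈ Finset.HasAntidiagonal.antidiagonal k, coeff p.1 f * coeff p.2 g‖ * ρ ^ k
      ≤ (∑ p ∈ Finset.HasAntidiagonal.antidiagonal k, ‖coeff p.1 f * coeff p.2 g‖) * ρ ^ k := by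
        gcongr; exact norm_sum_le _ _
    _ = _ := by
        rw [Finset.sum_mul]
        refine Finset.sum_congr rfl fun p hp => ?_
        rw [← Finset.HasAntidiagonal.mem_antidiagonal.1 hp, norm_mul, pow_add]
        ring

lemma evalAt_mul (hf : ConvergesOn f R) (hg : ConvergesOn g R) (hz : ‖z‖ < R) :
    evalAt (f * g) z = evalAt f z * evalAt g z := by
  unfold evalAt
  rw [tsum_mul_tsum_eq_tsum_sum_antidiagonal_of_summable_norm (hf.summable_norm hz)
    (hg.summable_norm hz)]
  refine tsum_congr fun k => ?_
  rw [coeff_mul, Finset.sum_mul]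
  refine Finset.sum_congr rfl fun p hp => ?_
  rw [← Finset.HasAntidiagonal.mem_antidiagonal.1 hp, pow_add]
  ring

lemma derivative (hf : ConvergesOn f R) : ConvergesOn (d⁄dX 𝕜 f) R := by
  intro ρ h0 hρ
  obtain ⟨σ, hσ1, hσ2⟩ := exists_between hρ
  have hσ0 : 0 < σ := h0.trans_lt hσ1
  have hs := (summable_nat_add_iff 1).2 (hf σ hσ0.le hσ2)
  have hlim : Filter.Tendsto (fun k : ℕ => ((k : ℝ) + 1) * (ρ / σ) ^ k) Filter.atTop (nhds 0) := by
    have hq0 : 0 ≤ ρ / σ := by positivity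
    have hq1 : ρ / σ < 1 := (div_lt_one hσ0).2 hσ1
    have h1 := tendsto_self_mul_const_pow_of_lt_one hq0 hq1
    have h2 := tendsto_pow_atTop_nhds_zero_of_lt_one hq0 hq1
    simpa [add_mul] using h1.add h2
  obtain ⟨C, hC⟩ := hlim.bddAbove_range
  refine Summable.of_nonneg_of_le (fun k => by positivity) (fun k => ?_) (hs.mul_left (C / σ))
  have hk : ((k : ℝ) + 1) * (ρ / σ) ^ k ≤ C := hC ⟨k, rfl⟩
  rw [coeff_derivative, norm_mul]
  have hn : ‖(k : 𝕜) + 1‖ = (k : ℝ) + 1 := by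
    have := RCLike.norm_natCast (K := 𝕜) (k + 1)
    push_cast at this
    exact this
  rw [hn]
  have e : ρ ^ k = (ρ / σ) ^ k * σ ^ k := by rw [div_pow]; field_simp
  calc ‖coeff (k + 1) f‖ * ((k : ℝ) + 1) * ρ ^ k
      = (((k : ℝ) + 1) * (ρ / σ) ^ k) * (‖coeff (k + 1) f‖ * σ ^ k) := by rw [e]; ring
    _ ≤ C * (‖coeff (k + 1) f‖ * σ ^ k) := by gcongr
    _ = _ := by rw [pow_succ]; field_simp

lemma hasDerivAt (hf : ConvergesOn f R) (hz : ‖z‖ < R) :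
    HasDerivAt (evalAt f) (evalAt (d⁄dX 𝕜 f) z) z := by
  obtain ⟨ρ, hρ1, hρ2⟩ := exists_between hz
  have hρ0 : 0 < ρ := (norm_nonneg z).trans_lt hρ1
  have hd := (hf.derivative) ρ hρ0.le hρ2
  let u : ℕ → ℝ := fun k => ‖coeff k f‖ * k * ρ ^ (k - 1)
  have hu : Summable u := by
    refine (summable_nat_add_iff 1).1 (hd.congr fun k => ?_)
    have hn : ‖(k : 𝕜) + 1‖ = (k : ℝ) + 1 := by
      have := RCLike.norm_natCast (K := 𝕜) (k + 1)
      push_cast at this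
      exact this
    simp [u, coeff_derivative, hn]
  have key := hasDerivAt_tsum_of_isPreconnected (g := fun k (w : 𝕜) => coeff k f * w ^ k)
    (g' := fun k w => coeff k f * (k * w ^ (k - 1))) hu (Metric.isOpen_ball (x := (0 : 𝕜)) (ε := ρ))
    (convex_ball (0 : 𝕜) ρ).isPreconnected
    (fun k y _ => (hasDerivAt_pow k y).const_mul _)
    (fun k y hy => by
      have hy' : ‖y‖ ≤ ρ := (mem_ball_zero_iff.1 hy).le
      rw [norm_mul, norm_mul, norm_pow, RCLike.norm_natCast, ← mul_assoc]
      exact mul_le_mul_of_nonneg_left (pow_le_pow_left₀ (norm_nonneg _) hy' _) (by positivity))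
    (Metric.mem_ball_self hρ0) (hf.hasSum (z := 0) (by simpa using hρ0.trans hρ2)).summable
    (mem_ball_zero_iff.2 hρ1)
  have hsum : Summable fun k => coeff k f * (k * z ^ (k - 1)) := by
    refine Summable.of_norm_bounded hu fun k => ?_
    rw [norm_mul, norm_mul, norm_pow, RCLike.norm_natCast, ← mul_assoc]
    exact mul_le_mul_of_nonneg_left (pow_le_pow_left₀ (norm_nonneg _) hρ1.le _) (by positivity)
  have e : evalAt (d⁄dX 𝕜 f) z = ∑' k, coeff k f * (k * z ^ (k - 1)) := by
    rw [hsum.tsum_eq_zero_add]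
    simp [evalAt, coeff_derivative, mul_assoc]
  rw [e]
  exact key

/-- A function vanishing near 0 has a derivative vanishing near 0, so each coefficient is reached by
repeated differentiation. Through `eq_of_eventually` this turns differential equations for sums into
identities of formal series. -/
lemma coeff_eq_zero_of_eventually (n : ℕ) : ∀ {f : PowerSeries 𝕜}, ConvergesOn f R → 0 < R →
    (∀ᶠ z in nhds (0 : 𝕜), evalAt f z = 0) → coeff n f = 0 := by
  induction n with
  | zero =>
    intro f hf hR h
    have h0 := h.self_of_nhds
    have : evalAt f 0 = coeff 0 f := by
      unfold evalAt
      rw [tsum_eq_single 0 (fun k hk => by simp [hk])]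
      simp
    rw [← this, h0]
  | succ n ih =>
    intro f hf hR h
    have h' : ∀ᶠ z in nhds (0 : 𝕜), evalAt (d⁄dX 𝕜 f) z = 0 := by
      have hball : ∀ᶠ z in nhds (0 : 𝕜), ‖z‖ < R := by
        filter_upwards [Metric.ball_mem_nhds (0 : 𝕜) hR] with z hz
        simpa using hz
      filter_upwards [h.eventually_nhds, hball] with z hz hzR
      have h1 := hf.hasDerivAt hzR
      have h2 : HasDerivAt (evalAt f) 0 z :=
        (hasDerivAt_const z (0 : 𝕜)).congr_of_eventuallyEq hz
      exact h1.unique h2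
    have := ih hf.derivative hR h'
    rw [coeff_derivative] at this
    have hne : (n : 𝕜) + 1 ≠ 0 := by exact_mod_cast Nat.succ_ne_zero n
    exact (mul_eq_zero.1 this).resolve_right hne

lemma eq_of_eventually (hf : ConvergesOn f R) (hg : ConvergesOn g R) (hR : 0 < R)
    (h : ∀ᶠ z in nhds (0 : 𝕜), evalAt f z = evalAt g z) : f = g := by
  rw [← sub_eq_zero]
  ext n
  refine coeff_eq_zero_of_eventually n (hf.sub hg) hR ?_
  filter_upwards [h, Metric.ball_mem_nhds (0 : 𝕜) hR] with z hz hzR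
  rw [hf.evalAt_sub hg (by simpa using hzR), hz, sub_self]

end ConvergesOn

lemma convergesOn_C (a : 𝕜) (R : ℝ) : ConvergesOn (C a) R := by
  intro ρ _ _
  refine summable_of_ne_finset_zero (s := {0}) fun k hk => ?_
  have : k ≠ 0 := by simpa using hk
  simp [coeff_C, this]

lemma evalAt_C (a z : 𝕜) : evalAt (C a) z = a := by
  unfold evalAt
  rw [tsum_eq_single 0 (fun k hk => by simp [coeff_C, hk])]
  simp

lemma convergesOn_X (R : ℝ) : ConvergesOn (X : PowerSeries 𝕜) R := by
  intro ρ _ _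
  refine summable_of_ne_finset_zero (s := {1}) fun k hk => ?_
  have : k ≠ 1 := by simpa using hk
  simp [coeff_X, this]

lemma evalAt_X (z : 𝕜) : evalAt (X : PowerSeries 𝕜) z = z := by
  unfold evalAt
  rw [tsum_eq_single 1 (fun k hk => by simp [coeff_X, hk])]
  simp

end PowerSeriesEvaluation

/-! ### The solution φ of the linear equation for the inverse function of F. -/

section InverseProfile

open PowerSeries

/-- Two consecutive Taylor coefficients at `0` of the solution of
`(3 - u²) φ'' - (6 + 2u) φ' + 6 φ = 0`, `φ(0) = 1`, `φ'(0) = 2`. -/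
def phiPair : ℕ → ℚ × ℚ
  | 0 => (1, 2)
  | k + 1 =>
    ((phiPair k).2, (((k : ℚ) + 3) * ((k : ℚ) - 2) * (phiPair k).1 + 6 * ((k : ℚ) + 1) * (phiPair k).2)
      / (3 * ((k : ℚ) + 2) * ((k : ℚ) + 1)))

/-- The Taylor coefficients of `φ`. -/
def phiCoeff (k : ℕ) : ℚ := (phiPair k).1

lemma phiCoeff_zero : phiCoeff 0 = 1 := rfl

lemma phiCoeff_one : phiCoeff 1 = 2 := rfl

lemma phiCoeff_add_two (k : ℕ) : phiCoeff (k + 2) =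
    (((k : ℚ) + 3) * ((k : ℚ) - 2) * phiCoeff k + 6 * ((k : ℚ) + 1) * phiCoeff (k + 1))
      / (3 * ((k : ℚ) + 2) * ((k : ℚ) + 1)) := rfl

/-- The factor k - 2 in the recurrence is negative for k = 0, 1 only, so the induction starts from
the coefficients 2 and 3, computed by hand. -/
lemma phiCoeff_nonneg (k : ℕ) : 0 ≤ phiCoeff k := by
  suffices h : ∀ k, 0 ≤ phiCoeff (k + 2) ∧ 0 ≤ phiCoeff (k + 3) by
    match k with
    | 0 => simp [phiCoeff_zero]
    | 1 => simp [phiCoeff_one]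
    | k + 2 => exact (h k).1
  intro k
  induction k with
  | zero => constructor <;> norm_num [phiCoeff_add_two, phiCoeff_zero, phiCoeff_one]
  | succ k ih =>
    refine ⟨ih.2, ?_⟩
    rw [phiCoeff_add_two (k + 2)]
    have h1 := ih.1
    have h2 := ih.2
    push_cast
    have : (0 : ℚ) ≤ (k : ℚ) + 2 - 2 := by simp
    positivity

/-- The singular points ±√3 of the equation suggest decay like 3^(-k/2), and 3/5 is slightly larger
than 1/√3. Two consecutive bounds propagate through the recurrence from index 13 on. -/
lemma phiCoeff_le_geometric {N : ℕ} (hN : 13 ≤ N) {C : ℚ} (h0 : phiCoeff N ≤ C * (3 / 5) ^ N)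
    (h1 : phiCoeff (N + 1) ≤ C * (3 / 5) ^ (N + 1)) (j : ℕ) :
    phiCoeff (N + j) ≤ C * (3 / 5) ^ (N + j) := by
  suffices h : phiCoeff (N + j) ≤ C * (3 / 5) ^ (N + j) ∧
      phiCoeff (N + j + 1) ≤ C * (3 / 5) ^ (N + j + 1) from h.1
  induction j with
  | zero => exact ⟨h0, h1⟩
  | succ j ih =>
    refine ⟨ih.2, ?_⟩
    have hk : (13 : ℚ) ≤ ((N + j : ℕ) : ℚ) := by exact_mod_cast hN.trans (Nat.le_add_right _ _)
    obtain ⟨i1, i2⟩ := ih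
    change phiCoeff (N + j + 2) ≤ C * (3 / 5) ^ (N + j + 2)
    generalize N + j = k at *
    have hC : 0 ≤ C * (3 / 5) ^ k := (phiCoeff_nonneg k).trans i1
    rw [phiCoeff_add_two, div_le_iff₀ (by positivity)]
    rw [pow_succ] at i2
    rw [pow_succ, pow_succ]
    have e1 := mul_le_mul_of_nonneg_left i1
      (by nlinarith : (0 : ℚ) ≤ ((k : ℚ) + 3) * ((k : ℚ) - 2))
    have e2 := mul_le_mul_of_nonneg_left i2 (by positivity : (0 : ℚ) ≤ 6 * ((k : ℚ) + 1))
    -- The quadratic is 25 times the slack 3(k+2)(k+1)(3/5)² - (k+3)(k-2) - 6(k+1)(3/5); its larger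
    -- root lies between 12 and 13.
    have e3 : 0 ≤ (C * (3 / 5) ^ k) * (2 * (k : ℚ) ^ 2 - 34 * k + 114) :=
      mul_nonneg hC (by nlinarith)
    nlinarith

/-- The formal Taylor series of `φ`. -/
noncomputable def phiSeries (𝕜 : Type*) [RCLike 𝕜] : PowerSeries 𝕜 :=
  PowerSeries.mk fun k => ((phiCoeff k : ℚ) : 𝕜)

variable (𝕜 : Type*) [RCLike 𝕜]

lemma coeff_phiSeries (k : ℕ) : coeff k (phiSeries 𝕜) = ((phiCoeff k : ℚ) : 𝕜) := by
  simp [phiSeries]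

lemma norm_coeff_phiSeries (k : ℕ) : ‖coeff k (phiSeries 𝕜)‖ = ((phiCoeff k : ℚ) : ℝ) := by
  rw [coeff_phiSeries]
  have h : ((phiCoeff k : ℚ) : 𝕜) = (((phiCoeff k : ℚ) : ℝ) : 𝕜) := by push_cast; rfl
  rw [h, RCLike.norm_ofReal, abs_of_nonneg]
  exact_mod_cast phiCoeff_nonneg k

lemma convergesOn_phiSeries : ConvergesOn (phiSeries 𝕜) (5 / 3) := by
  intro ρ h0 hρ
  simp_rw [norm_coeff_phiSeries]
  obtain ⟨C, hC0, hC1⟩ : ∃ C : ℚ, phiCoeff 13 ≤ C * (3 / 5) ^ 13 ∧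
      phiCoeff 14 ≤ C * (3 / 5) ^ 14 :=
    ⟨max (phiCoeff 13 / (3 / 5) ^ 13) (phiCoeff 14 / (3 / 5) ^ 14),
      (div_le_iff₀ (by positivity)).1 (le_max_left _ _),
      (div_le_iff₀ (by positivity)).1 (le_max_right _ _)⟩
  have hb := phiCoeff_le_geometric le_rfl hC0 hC1
  refine (summable_nat_add_iff 13).1 ?_
  have hg : Summable fun k => (3 / 5 * ρ) ^ k :=
    summable_geometric_of_lt_one (by positivity) (by linarith)
  refine Summable.of_nonneg_of_le (fun k => ?_) (fun k => ?_)
    (((summable_nat_add_iff 13).2 hg).mul_left (C : ℝ))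
  · have : (0 : ℝ) ≤ ((phiCoeff (k + 13) : ℚ) : ℝ) := by exact_mod_cast phiCoeff_nonneg _
    positivity
  · have := hb k
    rw [add_comm 13 k] at this
    have h' : ((phiCoeff (k + 13) : ℚ) : ℝ) ≤ (C : ℝ) * (3 / 5) ^ (k + 13) := by
      have h2 := (Rat.cast_le (K := ℝ)).2 this
      push_cast at h2
      exact h2
    rw [mul_pow, ← mul_assoc]
    gcongr

lemma phiSeries_ode : (C (3 : 𝕜) - X * X) * d⁄dX 𝕜 (d⁄dX 𝕜 (phiSeries 𝕜))
    - (C (6 : 𝕜) + C 2 * X) * d⁄dX 𝕜 (phiSeries 𝕜) + C 6 * phiSeries 𝕜 = 0 := by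
  have hrec : ∀ k : ℕ, 3 * ((k : 𝕜) + 2) * ((k : 𝕜) + 1) * ((phiCoeff (k + 2) : ℚ) : 𝕜) =
      ((k : 𝕜) + 3) * ((k : 𝕜) - 2) * ((phiCoeff k : ℚ) : 𝕜)
        + 6 * ((k : 𝕜) + 1) * ((phiCoeff (k + 1) : ℚ) : 𝕜) := by
    intro k
    have h : 3 * ((k : ℚ) + 2) * ((k : ℚ) + 1) * phiCoeff (k + 2) =
      ((k : ℚ) + 3) * ((k : ℚ) - 2) * phiCoeff k + 6 * ((k : ℚ) + 1) * phiCoeff (k + 1) := by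
      rw [phiCoeff_add_two]
      field_simp
    exact_mod_cast congrArg (fun q : ℚ => (q : 𝕜)) h
  have e : (C (3 : 𝕜) - X * X) * d⁄dX 𝕜 (d⁄dX 𝕜 (phiSeries 𝕜))
    - (C (6 : 𝕜) + C 2 * X) * d⁄dX 𝕜 (phiSeries 𝕜) + C 6 * phiSeries 𝕜 =
    C 3 * d⁄dX 𝕜 (d⁄dX 𝕜 (phiSeries 𝕜)) - X * (X * d⁄dX 𝕜 (d⁄dX 𝕜 (phiSeries 𝕜)))
    - C 6 * d⁄dX 𝕜 (phiSeries 𝕜) - C 2 * (X * d⁄dX 𝕜 (phiSeries 𝕜)) + C 6 * phiSeries 𝕜 := by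
    ring
  rw [e]
  ext n
  match n with
  | 0 =>
    have := hrec 0
    simp only [map_add, map_sub, coeff_C_mul, coeff_zero_X_mul, coeff_derivative,
      coeff_phiSeries, map_zero] at this ⊢
    push_cast at this ⊢
    linear_combination this
  | 1 =>
    have := hrec 1
    simp only [map_add, map_sub, coeff_C_mul, coeff_zero_X_mul, coeff_succ_X_mul,
      coeff_derivative, coeff_phiSeries, map_zero] at this ⊢
    push_cast at this ⊢
    linear_combination this
  | k + 2 =>
    have := hrec (k + 2)
    simp only [map_add, map_sub, coeff_C_mul, coeff_succ_X_mul,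
      coeff_derivative, coeff_phiSeries, map_zero] at this ⊢
    push_cast at this ⊢
    linear_combination this

variable {𝕜}

/-- The function `φ`; the equilibrium distribution function `F` satisfies
`φ(1 - F(x)) = 9 / 2 * (1 - x)`. -/
noncomputable def phi (z : 𝕜) : 𝕜 := evalAt (phiSeries 𝕜) z

/-- The derivative of `φ`. -/
noncomputable def phi' (z : 𝕜) : 𝕜 := evalAt (d⁄dX 𝕜 (phiSeries 𝕜)) z

/-- The second derivative of `φ`. -/
noncomputable def phi'' (z : 𝕜) : 𝕜 := evalAt (d⁄dX 𝕜 (d⁄dX 𝕜 (phiSeries 𝕜))) z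

lemma hasDerivAt_phi {z : 𝕜} (hz : ‖z‖ < 5 / 3) : HasDerivAt phi (phi' z) z :=
  (convergesOn_phiSeries 𝕜).hasDerivAt hz

lemma hasDerivAt_phi' {z : 𝕜} (hz : ‖z‖ < 5 / 3) : HasDerivAt phi' (phi'' z) z :=
  (convergesOn_phiSeries 𝕜).derivative.hasDerivAt hz

lemma phi_ode {z : 𝕜} (hz : ‖z‖ < 5 / 3) :
    (3 - z * z) * phi'' z - (6 + 2 * z) * phi' z + 6 * phi z = 0 := by
  have h0 := convergesOn_phiSeries 𝕜
  have h1 := h0.derivative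
  have h2 := h1.derivative
  have hX := convergesOn_X (𝕜 := 𝕜) (5 / 3)
  have hC := fun a => convergesOn_C (𝕜 := 𝕜) a (5 / 3)
  have h := congrArg (fun f => evalAt f z) (phiSeries_ode 𝕜)
  have hz0 : evalAt (0 : PowerSeries 𝕜) z = 0 := by simp [evalAt]
  simp only [hz0] at h
  rw [((((hC 3).sub (hX.mul hX)).mul h2).sub (((hC 6).add ((hC 2).mul hX)).mul h1)).evalAt_add
      ((hC 6).mul h0) hz,
    (((hC 3).sub (hX.mul hX)).mul h2).evalAt_sub (((hC 6).add ((hC 2).mul hX)).mul h1) hz,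
    ((hC 3).sub (hX.mul hX)).evalAt_mul h2 hz, ((hC 6).add ((hC 2).mul hX)).evalAt_mul h1 hz,
    (hC 6).evalAt_mul h0 hz, (hC 3).evalAt_sub (hX.mul hX) hz, hX.evalAt_mul hX hz,
    (hC 6).evalAt_add ((hC 2).mul hX) hz, (hC 2).evalAt_mul hX hz] at h
  simp only [evalAt_C, evalAt_X] at h
  exact h

lemma evalAt_zero_right (f : PowerSeries 𝕜) : evalAt f 0 = coeff 0 f := by
  unfold evalAt
  rw [tsum_eq_single 0 (fun k hk => by simp [hk])]
  simp

lemma phi_zero : phi (0 : 𝕜) = 1 := by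
  rw [phi, evalAt_zero_right, coeff_phiSeries, phiCoeff_zero]
  simp

lemma phi'_zero : phi' (0 : 𝕜) = 2 := by
  rw [phi', evalAt_zero_right, coeff_derivative, coeff_phiSeries, phiCoeff_one]
  simp

/-- The left side has derivative -(1 - u)(2 - u) times the differential equation, hence is constant;
its value at 0 is 3 φ(0) - 6 φ'(0) = -9. -/
lemma phi_first_integral {u : ℝ} (hu : |u| < 5 / 3) :
    phi u * (3 - 12 * u + 9 * u ^ 2 - 2 * u ^ 3)
      - phi' u * ((3 - u ^ 2) * ((1 - u) * (2 - u))) = -9 := by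
  let I : ℝ → ℝ := fun u => phi u * (3 - 12 * u + 9 * u ^ 2 - 2 * u ^ 3)
      - phi' u * ((3 - u ^ 2) * ((1 - u) * (2 - u)))
  have hder : ∀ v ∈ Metric.ball (0 : ℝ) (5 / 3), HasDerivAt I 0 v := by
    intro v hv
    have hv' : ‖v‖ < 5 / 3 := by simpa using hv
    have hp : HasDerivAt (fun u : ℝ => 3 - 12 * u + 9 * u ^ 2 - 2 * u ^ 3)
        (-12 + 18 * v - 6 * v ^ 2) v := by
      have := ((((hasDerivAt_id v).const_mul 12).const_sub 3).add
        (((hasDerivAt_id v).pow 2).const_mul 9)).sub (((hasDerivAt_id v).pow 3).const_mul 2)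
      refine HasDerivAt.congr_deriv this ?_
      simp; ring
    have hq : HasDerivAt (fun u : ℝ => (3 - u ^ 2) * ((1 - u) * (2 - u)))
        (-(2 * v) * ((1 - v) * (2 - v)) + (3 - v ^ 2) * (2 * v - 3)) v := by
      have := (((hasDerivAt_id v).pow 2).const_sub 3).mul
        (((hasDerivAt_id v).const_sub 1).mul ((hasDerivAt_id v).const_sub 2))
      refine HasDerivAt.congr_deriv this ?_
      simp only [id, Pi.mul_apply, Pi.pow_apply]
      push_cast
      ring
    have := ((hasDerivAt_phi hv').mul hp).sub ((hasDerivAt_phi' hv').mul hq)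
    refine HasDerivAt.congr_deriv this ?_
    have ode := phi_ode hv'
    linear_combination (-((1 - v) * (2 - v))) * ode
  have hc := (convex_ball (0 : ℝ) (5 / 3)).is_const_of_fderivWithin_eq_zero (𝕜 := ℝ) (f := I)
    (fun v hv => (hder v hv).differentiableAt.differentiableWithinAt)
    (fun v hv => by
      rw [fderivWithin_of_isOpen Metric.isOpen_ball hv]
      ext
      simp [(hder v hv).deriv])
    (x := u) (y := 0) (by simpa using hu) (by simp)
  change I u = -9
  rw [hc]
  simp only [I, phi_zero, phi'_zero]
  norm_num

/-- The coefficient of φ' in the first integral vanishes at u = 1, which makes this value exact. It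
is the source of the endpoint 7/9 = 1 - φ(0)/φ(1). -/
lemma phi_one : phi (1 : ℝ) = 9 / 2 := by
  have := phi_first_integral (u := 1) (by norm_num)
  norm_num at this
  linarith

lemma phi_ofReal (u : ℝ) (hu : |u| < 5 / 3) : phi (u : ℂ) = ((phi u : ℝ) : ℂ) := by
  have h := ((convergesOn_phiSeries ℝ).hasSum (z := u) hu)
  have h' := (Complex.hasSum_ofReal (L := SummationFilter.unconditional ℕ)).2 h
  refine (h'.congr_fun ?_).tsum_eq
  intro k
  simp [coeff_phiSeries]

lemma phi'_ofReal (u : ℝ) (hu : |u| < 5 / 3) : phi' (u : ℂ) = ((phi' u : ℝ) : ℂ) := by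
  have h := ((convergesOn_phiSeries ℝ).derivative.hasSum (z := u) hu)
  have h' := (Complex.hasSum_ofReal (L := SummationFilter.unconditional ℕ)).2 h
  refine (h'.congr_fun ?_).tsum_eq
  intro k
  simp [coeff_derivative, coeff_phiSeries]

lemma phi_conj (z : ℂ) : phi (starRingEnd ℂ z) = starRingEnd ℂ (phi z) := by
  simp [phi, evalAt, Complex.conj_tsum, coeff_phiSeries]

lemma phi'_conj (z : ℂ) : phi' (starRingEnd ℂ z) = starRingEnd ℂ (phi' z) := by
  simp [phi', evalAt, Complex.conj_tsum, coeff_phiSeries, coeff_derivative]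

end InverseProfile

/-! ### Integer tables and certified checks along the edges of the trapezoid. -/

section FrontierEstimates

/-- The first Taylor coefficients of `φ`, multiplied by `10 ^ 30` and rounded. -/
def phiTable : List ℕ :=
  [1000000000000000000000000000000, 2000000000000000000000000000000,
   1000000000000000000000000000000, 222222222222222222222222222222,
   111111111111111111111111111111, 66666666666666666666666666667, 39506172839506172839506172840,
   23985890652557319223985890653, 14462081128747795414462081129, 8766085309295185838395714939,
   5288392448886276046769873930, 3192893069436279312822522699, 1921019589057997837147357038,
   1155166532395613328397964886, 692776424698823287888543620, 415083379962427146001078546,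
   248172076159969991485222177, 148227978213927783513276604, 88380202654000709862116898,
   52644693324376619609251078, 31313371167301029078180615, 18608507812216650177175855,
   11045027162771950909589417, 6550344629681613966309613, 3880713248962583443324538,
   2297394930920429578579879, 1358847645908635385703465, 803182606018282891156307,
   474371051026178155563022, 280000530002508250616510, 165158298600588516854815,
   97365215652427620633165, 57364313850233644829173, 33780319094866948785196,
   19881471397364522557962, 11695982149841422253810, 6877200631202723116912,
   4042101339399632557440, 2374707096804535154286, 1394596287276410165451,
   818675898740635441547, 480423749212458110382, 281823589014414054712, 165268862694760143818,
   96885452220083406552, 56780275156299604473, 33266112234242437639, 19484417961648673515,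
   11409034255645925160, 6678818350245966816, 3908730198464987030, 2287013216671978955,
   1337812426998058392, 782394103596692130, 457463952852132387, 267422657754909497,
   156295739536021702, 91329638515319036, 53356822195402728, 31166567428847941,
   18201494302194716, 10627976980176569, 6204662414504153, 3621725166013165, 2113690106590540,
   1233391227507994, 719603052176008, 419780704606207, 244843351014117, 142789023385337,
   83260910871890, 48543516524283, 28298558920671, 16494683715545, 9613236196528, 5602017429450,
   3264133878176, 1901704960796, 1107820753896, 645282369231, 375823228059, 218863581728,
   127443906412, 74203209438, 43200026865, 25148103197, 14638145202, 8519782085, 4958294139,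
   2885355476, 1678917593, 976841706, 568307738, 330604784, 192309488, 111856138, 65055843,
   37833942, 22001158, 12793209, 7438465, 4324722, 2514225, 1461579, 849596, 493828, 287020,
   166810, 96941, 56334, 32734, 19020]

/-- Entries of `phiTable`. -/
def phiApprox (k : ℕ) : ℕ := phiTable.getD k 0

/-- The rounded Taylor coefficients of `φ'`. -/
def phiDerivApprox (k : ℕ) : ℕ := (k + 1) * phiApprox (k + 1)

/-- Horner evaluation at the Gaussian rational `(x - s + y i) / m` of the polynomial whose
coefficients, highest first, form the list; the value is `(A - A' + (B - B') i) / D`. -/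
def gaussHorner {α : Type} (m x s y : ℕ) (out : ℕ → ℕ → ℕ → ℕ → ℕ → α) :
    List ℕ → ℕ → ℕ → ℕ → ℕ → ℕ → α
  | [], A, A', B, B', D => out A A' B B' D
  | a :: p, A, A', B, B', D => gaussHorner m x s y out p
      (Nat.add (Nat.mul a (Nat.mul D m))
        (Nat.add (Nat.add (Nat.mul x A) (Nat.mul s A')) (Nat.mul y B')))
      (Nat.add (Nat.add (Nat.mul x A') (Nat.mul s A)) (Nat.mul y B))
      (Nat.add (Nat.add (Nat.mul x B) (Nat.mul s B')) (Nat.mul y A))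
      (Nat.add (Nat.add (Nat.mul x B') (Nat.mul s B)) (Nat.mul y A'))
      (Nat.mul D m)

/-- The absolute difference of two natural numbers. -/
def absDiff (a b : ℕ) : ℕ := Nat.add (Nat.sub a b) (Nat.sub b a)

/-- The first coefficients of `φ`, highest first. -/
def phiList : List ℕ := ((List.range 64).map phiApprox).reverse

/-- The first coefficients of `φ'`, highest first. -/
def phiDerivList : List ℕ := ((List.range 64).map phiDerivApprox).reverse

/-- Certifies `3.53 + L * w / (2 * 65536) ≤ ‖φ - 9 / 2‖`, up to truncation, at
`(x - 8192 + y i) / 65536`. -/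
def distTest (L w x y : ℕ) : Bool :=
  gaussHorner 65536 x 8192 y (fun A A' B B' D =>
    Nat.ble
      (Nat.pow (Nat.mul (Nat.mul (Nat.mul 2 (Nat.pow 10 30)) D)
        (Nat.add 23134208 (Nat.mul (Nat.mul 50 L) w))) 2)
      (Nat.mul (Nat.add
        (Nat.pow (absDiff (Nat.mul 2 A)
          (Nat.add (Nat.mul 2 A') (Nat.mul (Nat.mul 9 (Nat.pow 10 30)) D))) 2)
        (Nat.pow (Nat.mul 2 (absDiff B B')) 2)) (Nat.pow 6553600 2)))
    phiList 0 0 0 0 1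

/-- Certifies `1 / 5 + L * w / (2 * 65536) ≤ Re φ'`, up to truncation, at
`(x - 8192 + y i) / 65536`. -/
def derivTest (L w x y : ℕ) : Bool :=
  gaussHorner 65536 x 8192 y (fun A A' _ _ D =>
    Nat.ble
      (Nat.add (Nat.mul (Nat.mul (Nat.pow 10 30) D) (Nat.add 131072 (Nat.mul (Nat.mul 5 L) w)))
        (Nat.mul 655360 A'))
      (Nat.mul 655360 A))
    phiDerivList 0 0 0 0 1

/-- Adaptive bisection of the segment from `(x₀, y₀)` to `(x₁, y₁)` until `test` succeeds at the
midpoint of every piece. -/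
def bisect (test : ℕ → ℕ → ℕ → Bool) : ℕ → ℕ → ℕ → ℕ → ℕ → Bool
  | 0, _, _, _, _ => false
  | d + 1, x₀, y₀, x₁, y₁ =>
    (Nat.beq (Nat.mul 2 (Nat.div (Nat.add x₀ x₁) 2)) (Nat.add x₀ x₁) &&
      Nat.beq (Nat.mul 2 (Nat.div (Nat.add y₀ y₁) 2)) (Nat.add y₀ y₁)) &&
    (test (Nat.add (absDiff x₀ x₁) (absDiff y₀ y₁))
        (Nat.div (Nat.add x₀ x₁) 2) (Nat.div (Nat.add y₀ y₁) 2) ||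
      (bisect test d x₀ y₀ (Nat.div (Nat.add x₀ x₁) 2) (Nat.div (Nat.add y₀ y₁) 2) &&
        bisect test d (Nat.div (Nat.add x₀ x₁) 2) (Nat.div (Nat.add y₀ y₁) 2) x₁ y₁))

-- The three edges in the upper half plane join -1/8, -1/8 + 21/16 i, 11/8 + 9/16 i and 11/8. The
-- slanted one is cut at 5/8 + 15/16 i, so that smaller Lipschitz constants serve on the left half.
-- Coordinates are in units of 1/65536, the real part shifted by 1/8 to keep it nonnegative.
set_option maxRecDepth 100000 in
lemma bisect_distTest_left : bisect (distTest 18) 12 0 0 0 86016 = true := by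
  decide +kernel

set_option maxRecDepth 100000 in
lemma bisect_derivTest_left : bisect (derivTest 90) 12 0 0 0 86016 = true := by
  decide +kernel

set_option maxRecDepth 100000 in
lemma bisect_distTest_slanted_left : bisect (distTest 18) 12 0 86016 49152 61440 = true := by
  decide +kernel

set_option maxRecDepth 100000 in
lemma bisect_derivTest_slanted_left : bisect (derivTest 90) 12 0 86016 49152 61440 = true := by
  decide +kernel

set_option maxRecDepth 100000 in
lemma bisect_distTest_slanted_right : bisect (distTest 53) 12 49152 61440 98304 36864 = true := by
  decide +kernel

set_option maxRecDepth 100000 in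
lemma bisect_derivTest_slanted_right : bisect (derivTest 530) 12 49152 61440 98304 36864 = true := by
  decide +kernel

set_option maxRecDepth 100000 in
lemma bisect_distTest_right : bisect (distTest 53) 12 98304 0 98304 36864 = true := by
  decide +kernel

set_option maxRecDepth 100000 in
lemma bisect_derivTest_right : bisect (derivTest 530) 12 98304 0 98304 36864 = true := by
  decide +kernel

/-- The allowed residual is the divisor of the recurrence: each rounded entry is within one unit of
what the two preceding entries predict. -/
lemma phiApprox_recurrence : ∀ k : ℕ, k < 110 →
    |3 * ((k : ℤ) + 2) * (k + 1) * phiApprox (k + 2) - ((k + 3) * (k - 2) * phiApprox k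
      + 6 * (k + 1) * phiApprox (k + 1))| ≤ 3 * ((k : ℤ) + 2) * (k + 1) := by
  decide +kernel

/-- Rounding errors do not accumulate: if two consecutive errors are at most 6, the recurrence
together with a residual of one unit gives again at most 6. As before, the induction starts at index
2, where the recurrence weights become nonnegative. -/
lemma abs_phiCoeff_sub_phiApprox_le (k : ℕ) (hk : k < 112) :
    |10 ^ 30 * phiCoeff k - (phiApprox k : ℚ)| ≤ 6 := by
  suffices h : ∀ k, k + 3 < 112 → |10 ^ 30 * phiCoeff (k + 2) - (phiApprox (k + 2) : ℚ)| ≤ 6 ∧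
      |10 ^ 30 * phiCoeff (k + 3) - (phiApprox (k + 3) : ℚ)| ≤ 6 by
    match k with
    | 0 => norm_num [phiCoeff_zero, phiApprox, phiTable]
    | 1 => norm_num [phiCoeff_one, phiApprox, phiTable]
    | 2 => exact (h 0 (by norm_num)).1
    | k + 3 => exact (h k hk).2
  intro k
  induction k with
  | zero =>
    intro _
    constructor <;> rw [abs_le] <;>
      norm_num [phiCoeff_add_two, phiCoeff_zero, phiCoeff_one, phiApprox, phiTable]
  | succ k ih =>
    intro hk
    obtain ⟨h1, h2⟩ := ih (by omega)
    refine ⟨h2, ?_⟩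
    have hr := phiApprox_recurrence (k + 2) (by omega)
    have hr' : |3 * ((k : ℚ) + 2 + 2) * (k + 2 + 1) * phiApprox (k + 4) -
        ((k + 2 + 3) * (k + 2 - 2) * phiApprox (k + 2) + 6 * (k + 2 + 1) * phiApprox (k + 3))|
        ≤ 3 * ((k : ℚ) + 2 + 2) * (k + 2 + 1) := by
      have := (Int.cast_le (R := ℚ)).2 hr
      push_cast at this
      exact this
    change |10 ^ 30 * phiCoeff (k + 2 + 2) - (phiApprox (k + 4) : ℚ)| ≤ 6
    have hd : (0 : ℚ) < 3 * ((k : ℚ) + 2 + 2) * (k + 2 + 1) := by positivity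
    have e : 3 * ((k : ℚ) + 2 + 2) * (k + 2 + 1) * phiCoeff (k + 2 + 2) =
        ((k : ℚ) + 2 + 3) * (k + 2 - 2) * phiCoeff (k + 2)
          + 6 * (k + 2 + 1) * phiCoeff (k + 3) := by
      rw [phiCoeff_add_two (k + 2)]
      push_cast
      field_simp
    generalize phiCoeff (k + 2 + 2) = a2 at *
    generalize phiCoeff (k + 2) = a0 at *
    generalize phiCoeff (k + 3) = a1 at *
    generalize (phiApprox (k + 4) : ℚ) = p2 at *
    generalize (phiApprox (k + 2) : ℚ) = p0 at *
    generalize (phiApprox (k + 3) : ℚ) = p1 at *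
    have hk0 : (0 : ℚ) ≤ k := by positivity
    rw [abs_le] at *
    have m1 := mul_le_mul_of_nonneg_left h1.1 (by positivity : (0 : ℚ) ≤ ((k : ℚ) + 5) * k)
    have m2 := mul_le_mul_of_nonneg_left h1.2 (by positivity : (0 : ℚ) ≤ ((k : ℚ) + 5) * k)
    have m3 := mul_le_mul_of_nonneg_left h2.1 (by positivity : (0 : ℚ) ≤ 6 * ((k : ℚ) + 3))
    have m4 := mul_le_mul_of_nonneg_left h2.2 (by positivity : (0 : ℚ) ≤ 6 * ((k : ℚ) + 3))
    constructor
    · refine le_of_mul_le_mul_left ?_ hd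
      nlinarith
    · refine le_of_mul_le_mul_left ?_ hd
      nlinarith

end FrontierEstimates

/-! ### Soundness of the integer checks. -/

section FrontierSoundness

open PowerSeries

/-- The continuation receives an unreduced fraction with signs split into differences of natural
numbers. Only its complex value matters to the tests, so the numerators and the denominator are
existentially quantified. -/
lemma gaussHorner_spec {α : Type} {m x s y : ℕ} (hm : 0 < m) (out : ℕ → ℕ → ℕ → ℕ → ℕ → α)
    (l : List ℕ) : ∀ A A' B B' D : ℕ, 0 < D → ∃ a a' b b' d : ℕ, 0 < d ∧
      gaussHorner m x s y out l A A' B B' D = out a a' b b' d ∧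
      ((a : ℂ) - a' + (b - b') * Complex.I) / d =
        l.foldl (fun (v : ℂ) (c : ℕ) => (c : ℂ) + (((x : ℂ) - s + y * Complex.I) / m) * v)
          (((A : ℂ) - A' + (B - B') * Complex.I) / D) := by
  induction l with
  | nil => intro A A' B B' D hD; exact ⟨A, A', B, B', D, hD, rfl, rfl⟩
  | cons c l ih =>
    intro A A' B B' D hD
    obtain ⟨a, a', b, b', d, hd, h1, h2⟩ := ih
      (c * (D * m) + (x * A + s * A' + y * B')) (x * A' + s * A + y * B)
      (x * B + s * B' + y * A) (x * B' + s * B + y * A') (D * m) (Nat.mul_pos hD hm)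
    refine ⟨a, a', b, b', d, hd, h1, ?_⟩
    rw [h2, List.foldl_cons]
    congr 1
    have hm' : (m : ℂ) ≠ 0 := by exact_mod_cast hm.ne'
    have hD' : (D : ℂ) ≠ 0 := by exact_mod_cast hD.ne'
    push_cast
    field_simp
    ring_nf
    rw [Complex.I_sq]
    ring

lemma foldl_range_reverse (q : ℕ → ℕ) (z : ℂ) (n : ℕ) : ∀ v : ℂ,
    (((List.range n).map q).reverse).foldl (fun (v : ℂ) (c : ℕ) => (c : ℂ) + z * v) v =
      ∑ k ∈ Finset.range n, (q k : ℂ) * z ^ k + z ^ n * v := by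
  induction n with
  | zero => intro v; simp
  | succ n ih =>
    intro v
    rw [List.range_succ, List.map_append, List.reverse_append]
    simp only [List.map_cons, List.map_nil, List.reverse_cons, List.reverse_nil, List.nil_append,
      List.singleton_append, List.foldl_cons]
    rw [ih, Finset.sum_range_succ]
    ring

/-- The Gaussian rational with integer coordinates `x - 8192` and `y` over `65536`. -/
noncomputable def gridPoint (x y : ℕ) : ℂ := ((x : ℂ) - 8192 + y * Complex.I) / 65536

/-- The truncation of `φ`, with rounded coefficients, multiplied by `10 ^ 30`. -/
noncomputable def phiPoly (z : ℂ) : ℂ := ∑ k ∈ Finset.range 64, (phiApprox k : ℂ) * z ^ k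

/-- The truncation of `φ'`, with rounded coefficients, multiplied by `10 ^ 30`. -/
noncomputable def phiDerivPoly (z : ℂ) : ℂ := ∑ k ∈ Finset.range 64, (phiDerivApprox k : ℂ) * z ^ k

lemma cast_absDiff (a b : ℕ) : ((absDiff a b : ℕ) : ℝ) = |(a : ℝ) - b| := by
  change ((a - b + (b - a) : ℕ) : ℝ) = _
  rcases le_total a b with h | h
  · rw [Nat.sub_eq_zero_of_le h, zero_add, Nat.cast_sub h, abs_sub_comm, abs_of_nonneg]
    simpa using h
  · rw [Nat.sub_eq_zero_of_le h, add_zero, Nat.cast_sub h, abs_of_nonneg]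
    simpa using h

/-- The test is this inequality squared and cleared of denominators; 23134208 = 3.53 · 6553600 and
6553600 = 50 · 2 · 65536. -/
lemma distTest_sound {L w x y : ℕ} (h : distTest L w x y = true) :
    353 / 100 + (L : ℝ) * (w / (2 * 65536)) ≤
      ‖phiPoly (gridPoint x y) / 10 ^ 30 - 9 / 2‖ := by
  unfold distTest at h
  obtain ⟨a, a', b, b', d, hd, h1, h2⟩ := gaussHorner_spec (m := 65536) (x := x) (s := 8192)
    (y := y) (by norm_num) _ phiList 0 0 0 0 1 one_pos
  rw [h1] at h
  have h := Nat.le_of_ble_eq_true h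
  have hv : phiPoly (gridPoint x y) = ((a : ℂ) - a' + (b - b') * Complex.I) / d := by
    rw [h2, phiList, foldl_range_reverse, phiPoly, gridPoint]
    simp
  have hd' : (0 : ℝ) < d := by exact_mod_cast hd
  have h' : (2 * 10 ^ 30 * (d : ℝ) * (23134208 + 50 * L * w)) ^ 2 ≤
      (|2 * (a : ℝ) - (2 * a' + 9 * 10 ^ 30 * d)| ^ 2 + (2 * |(b : ℝ) - b'|) ^ 2)
        * 6553600 ^ 2 := by
    have := (Nat.cast_le (α := ℝ)).2 h
    simp only [Nat.mul_eq, Nat.add_eq, Nat.pow_eq, Nat.cast_mul, Nat.cast_add, Nat.cast_pow,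
      cast_absDiff] at this
    push_cast at this
    exact this
  have hn : phiPoly (gridPoint x y) / 10 ^ 30 - 9 / 2 =
      (((2 * (a : ℝ) - (2 * a' + 9 * 10 ^ 30 * d)) / (2 * 10 ^ 30 * d) : ℝ) : ℂ) +
      ((((b : ℝ) - b') / (10 ^ 30 * d) : ℝ) : ℂ) * Complex.I := by
    rw [hv]
    have : (d : ℂ) ≠ 0 := by exact_mod_cast hd.ne'
    push_cast
    field_simp
    ring
  rw [hn, Complex.norm_add_mul_I]
  apply Real.le_sqrt_of_sq_le
  rw [mul_pow 2 |_|, sq_abs, sq_abs] at h'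
  have e : 353 / 100 + (L : ℝ) * (w / (2 * 65536)) =
      (2 * 10 ^ 30 * (d : ℝ) * (23134208 + 50 * L * w)) / (2 * 10 ^ 30 * d * 6553600) := by
    field_simp
    ring
  rw [e, div_pow, div_le_iff₀ (by positivity)]
  refine h'.trans (le_of_eq ?_)
  field_simp

lemma derivTest_sound {L w x y : ℕ} (h : derivTest L w x y = true) :
    1 / 5 + (L : ℝ) * (w / (2 * 65536)) ≤ (phiDerivPoly (gridPoint x y) / 10 ^ 30).re := by
  unfold derivTest at h
  obtain ⟨a, a', b, b', d, hd, h1, h2⟩ := gaussHorner_spec (m := 65536) (x := x) (s := 8192)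
    (y := y) (by norm_num) _ phiDerivList 0 0 0 0 1 one_pos
  rw [h1] at h
  have h := Nat.le_of_ble_eq_true h
  have hv : phiDerivPoly (gridPoint x y) = ((a : ℂ) - a' + (b - b') * Complex.I) / d := by
    rw [h2, phiDerivList, foldl_range_reverse, phiDerivPoly, gridPoint]
    simp
  have hd' : (0 : ℝ) < d := by exact_mod_cast hd
  have h' : 10 ^ 30 * (d : ℝ) * (131072 + 5 * L * w) + 655360 * a' ≤ 655360 * a := by
    have := (Nat.cast_le (α := ℝ)).2 h
    simp only [Nat.mul_eq, Nat.add_eq, Nat.pow_eq, Nat.cast_mul, Nat.cast_add, Nat.cast_pow] at this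
    push_cast at this
    exact this
  have hn : phiDerivPoly (gridPoint x y) / 10 ^ 30 =
      ((((a : ℝ) - a') / (10 ^ 30 * d) : ℝ) : ℂ) +
      ((((b : ℝ) - b') / (10 ^ 30 * d) : ℝ) : ℂ) * Complex.I := by
    rw [hv]
    have : (d : ℂ) ≠ 0 := by exact_mod_cast hd.ne'
    push_cast
    field_simp
  rw [hn, Complex.add_re, Complex.re_ofReal_mul, Complex.I_re, Complex.ofReal_re, mul_zero,
    add_zero, le_div_iff₀ (by positivity)]
  linarith

lemma norm_pow_sub_pow_le {𝕜 : Type*} [RCLike 𝕜] {z c : 𝕜} {r : ℝ} (hz : ‖z‖ ≤ r) (hc : ‖c‖ ≤ r) (k : ℕ) :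
    ‖z ^ k - c ^ k‖ ≤ k * r ^ (k - 1) * ‖z - c‖ := by
  have hr : 0 ≤ r := (norm_nonneg z).trans hz
  induction k with
  | zero => simp
  | succ k ih =>
    have e : z ^ (k + 1) - c ^ (k + 1) = z * (z ^ k - c ^ k) + (z - c) * c ^ k := by ring
    have h1 : ‖c ^ k‖ ≤ r ^ k := by rw [norm_pow]; gcongr
    have h2 : r * (k * r ^ (k - 1) * ‖z - c‖) = k * r ^ k * ‖z - c‖ := by
      rcases k with _ | k
      · simp
      · simp only [Nat.add_sub_cancel, pow_succ]; ring
    calc ‖z ^ (k + 1) - c ^ (k + 1)‖ ≤ ‖z‖ * ‖z ^ k - c ^ k‖ + ‖z - c‖ * ‖c ^ k‖ := by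
          rw [e, ← norm_mul, ← norm_mul]; exact norm_add_le _ _
      _ ≤ r * (k * r ^ (k - 1) * ‖z - c‖) + ‖z - c‖ * r ^ k := by gcongr
      _ = _ := by rw [h2, Nat.add_sub_cancel]; push_cast; ring

/-- The hypothesis `hL` is the bound ∑ k q_k (s/32)^(k-1) ≤ L · 10^30 for the derivative on the disc
of radius s/32, multiplied by 32^63 to become a statement about natural numbers. -/
lemma norm_sum_sub_sum_le (q : ℕ → ℕ) {L s : ℕ}
    (hL : ∑ k ∈ Finset.range 64, k * q k * s ^ (k - 1) * 32 ^ (64 - k) ≤ L * 10 ^ 30 * 32 ^ 63)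
    {z c : ℂ} (hz : ‖z‖ ≤ s / 32) (hc : ‖c‖ ≤ s / 32) :
    ‖∑ k ∈ Finset.range 64, (q k : ℂ) * z ^ k - ∑ k ∈ Finset.range 64, (q k : ℂ) * c ^ k‖ ≤
      L * 10 ^ 30 * ‖z - c‖ := by
  have hL' : ∑ k ∈ Finset.range 64, (k : ℝ) * q k * s ^ (k - 1) * 32 ^ (64 - k) ≤
      L * 10 ^ 30 * 32 ^ 63 := by exact_mod_cast hL
  rw [← Finset.sum_sub_distrib]
  calc ‖∑ k ∈ Finset.range 64, ((q k : ℂ) * z ^ k - (q k : ℂ) * c ^ k)‖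
      ≤ ∑ k ∈ Finset.range 64, (q k : ℝ) * (k * ((s : ℝ) / 32) ^ (k - 1) * ‖z - c‖) := by
        refine norm_sum_le_of_le _ fun k _ => ?_
        rw [← mul_sub, norm_mul, Complex.norm_natCast]
        gcongr
        exact norm_pow_sub_pow_le hz hc k
    _ = (∑ k ∈ Finset.range 64, (k : ℝ) * q k * s ^ (k - 1) * 32 ^ (64 - k)) / 32 ^ 63
          * ‖z - c‖ := by
        rw [Finset.sum_div, Finset.sum_mul]
        refine Finset.sum_congr rfl fun k hk => ?_
        rcases k with _ | k
        · simp
        · have hk' : k + 1 < 64 := by simpa using hk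
          have e : (32 : ℝ) ^ 63 = 32 ^ k * 32 ^ (64 - (k + 1)) := by
            rw [← pow_add]; congr 1; omega
          rw [e, Nat.add_sub_cancel, div_pow]
          field_simp
    _ ≤ L * 10 ^ 30 * ‖z - c‖ := by
        gcongr
        rw [div_le_iff₀ (by positivity)]
        exact hL'

/-- `w` is the ℓ¹ length of a piece in grid units, so every point of the piece is within w / (2 ·
65536) of the midpoint where the test is run. Divisibility by 2 is checked at each level, hence
midpoints are exact grid points. -/
lemma bisect_sound {test : ℕ → ℕ → ℕ → Bool} {P : ℂ → Prop} {r : ℝ}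
    (htest : ∀ w x y : ℕ, test w x y = true → ∀ z : ℂ, ‖z‖ ≤ r → ‖gridPoint x y‖ ≤ r →
      ‖z - gridPoint x y‖ ≤ w / (2 * 65536) → P z) (d : ℕ) :
    ∀ x₀ y₀ x₁ y₁ : ℕ, bisect test d x₀ y₀ x₁ y₁ = true → ‖gridPoint x₀ y₀‖ ≤ r →
      ‖gridPoint x₁ y₁‖ ≤ r → ∀ t : ℝ, 0 ≤ t → t ≤ 1 →
      P ((1 - t) * gridPoint x₀ y₀ + t * gridPoint x₁ y₁) := by
  induction d with
  | zero => intro x₀ y₀ x₁ y₁ h; simp [bisect] at h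
  | succ d ih =>
    intro x₀ y₀ x₁ y₁ h h0 h1 t ht0 ht1
    rw [bisect] at h
    simp only [Bool.and_eq_true, Bool.or_eq_true, Nat.beq_eq, Nat.mul_eq, Nat.add_eq] at h
    obtain ⟨⟨hx, hy⟩, h⟩ := h
    generalize Nat.div (x₀ + x₁) 2 = cx at *
    generalize Nat.div (y₀ + y₁) 2 = cy at *
    have hx' : 2 * (cx : ℂ) = x₀ + x₁ := by exact_mod_cast hx
    have hy' : 2 * (cy : ℂ) = y₀ + y₁ := by exact_mod_cast hy
    have hmid : gridPoint cx cy = (gridPoint x₀ y₀ + gridPoint x₁ y₁) / 2 := by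
      unfold gridPoint
      linear_combination (1 / 131072 : ℂ) * hx' + (Complex.I / 131072) * hy'
    have hball : ∀ s : ℝ, 0 ≤ s → s ≤ 1 →
        ‖((1 - s : ℝ) : ℂ) * gridPoint x₀ y₀ + (s : ℂ) * gridPoint x₁ y₁‖ ≤ r := by
      intro s hs0 hs1
      refine (norm_add_le _ _).trans ?_
      rw [norm_mul, norm_mul, Complex.norm_of_nonneg (by linarith), Complex.norm_of_nonneg hs0]
      nlinarith
    have hcr : ‖gridPoint cx cy‖ ≤ r := by
      have := hball (1 / 2) (by norm_num) (by norm_num)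
      convert this using 2
      rw [hmid]
      push_cast
      ring
    rcases h with h | ⟨hl, hr⟩
    · refine htest _ _ _ h _ ?_ hcr ?_
      · simpa using hball t ht0 ht1
      · have e : (1 - (t : ℂ)) * gridPoint x₀ y₀ + t * gridPoint x₁ y₁ - gridPoint cx cy =
            ((t - 1 / 2 : ℝ) : ℂ) * (gridPoint x₁ y₁ - gridPoint x₀ y₀) := by
          rw [hmid]; push_cast; ring
        have hn : ‖gridPoint x₁ y₁ - gridPoint x₀ y₀‖ ≤
            (|(x₀ : ℝ) - x₁| + |(y₀ : ℝ) - y₁|) / 65536 := by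
          have e2 : gridPoint x₁ y₁ - gridPoint x₀ y₀ =
              ((((x₁ : ℝ) - x₀) / 65536 : ℝ) : ℂ) +
              ((((y₁ : ℝ) - y₀) / 65536 : ℝ) : ℂ) * Complex.I := by
            unfold gridPoint; push_cast; ring
          rw [e2]
          refine (norm_add_le _ _).trans ?_
          rw [norm_mul, Complex.norm_I, mul_one, Complex.norm_real, Complex.norm_real,
            Real.norm_eq_abs, Real.norm_eq_abs, abs_div, abs_div, abs_sub_comm (x₁ : ℝ),
            abs_sub_comm (y₁ : ℝ), abs_of_pos (by norm_num : (0 : ℝ) < 65536)]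
          rw [add_div]
        rw [e, norm_mul, Complex.norm_real, Real.norm_eq_abs]
        have ht : |t - 1 / 2| ≤ 1 / 2 := by rw [abs_le]; constructor <;> linarith
        push_cast [cast_absDiff]
        calc |t - 1 / 2| * ‖gridPoint x₁ y₁ - gridPoint x₀ y₀‖
            ≤ 1 / 2 * ((|(x₀ : ℝ) - x₁| + |(y₀ : ℝ) - y₁|) / 65536) := by gcongr
          _ = _ := by ring
    · rcases le_total t (1 / 2) with ht | ht
      · have := ih _ _ _ _ hl h0 hcr (2 * t) (by linarith) (by linarith)
        convert this using 1
        rw [hmid]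
        push_cast
        ring
      · have := ih _ _ _ _ hr hcr h1 (2 * t - 1) (by linarith) (by linarith)
        convert this using 1
        rw [hmid]
        push_cast
        ring

end FrontierSoundness

/-! ### Truncation errors, and lower bounds for |φ - 9/2| and Re φ' on the trapezoid. -/

section FrontierBounds

open PowerSeries

/-- The error splits into rounding of the first 64 coefficients and a tail dominated by the summable
sequence `g`. -/
lemma norm_evalAt_sub_le {f : PowerSeries ℂ} (hf : ConvergesOn f (5 / 3)) {q : ℕ → ℕ} {e : ℝ}
    (he : ∀ k < 64, ‖coeff k f - (q k : ℂ) / 10 ^ 30‖ ≤ e) {g : ℕ → ℝ} {T : ℝ} (hg : HasSum g T)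
    (htail : ∀ j, ‖coeff (j + 64) f‖ * (3 / 2) ^ (j + 64) ≤ g j) {z : ℂ} (hz : ‖z‖ ≤ 3 / 2) :
    ‖evalAt f z - (∑ k ∈ Finset.range 64, (q k : ℂ) * z ^ k) / 10 ^ 30‖ ≤
      e * ∑ k ∈ Finset.range 64, (3 / 2 : ℝ) ^ k + T := by
  have hs := (hf.hasSum (z := z) (by linarith)).summable
  have hsplit : evalAt f z = ∑ k ∈ Finset.range 64, coeff k f * z ^ k
      + ∑' j, coeff (j + 64) f * z ^ (j + 64) := (hs.sum_add_tsum_nat_add 64).symm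
  have h1 : ‖∑' j, coeff (j + 64) f * z ^ (j + 64)‖ ≤ T := by
    refine tsum_of_norm_bounded hg fun j => ?_
    rw [norm_mul, norm_pow]
    refine le_trans ?_ (htail j)
    gcongr
  have h2 : ‖∑ k ∈ Finset.range 64, (coeff k f - (q k : ℂ) / 10 ^ 30) * z ^ k‖ ≤
      e * ∑ k ∈ Finset.range 64, (3 / 2 : ℝ) ^ k := by
    rw [Finset.mul_sum]
    refine norm_sum_le_of_le _ fun k hk => ?_
    have hk' := he k (Finset.mem_range.1 hk)
    rw [norm_mul, norm_pow]
    gcongr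
    exact (norm_nonneg _).trans hk'
  have e1 : evalAt f z - (∑ k ∈ Finset.range 64, (q k : ℂ) * z ^ k) / 10 ^ 30 =
      ∑ k ∈ Finset.range 64, (coeff k f - (q k : ℂ) / 10 ^ 30) * z ^ k +
        ∑' j, coeff (j + 64) f * z ^ (j + 64) := by
    rw [hsplit, Finset.sum_div, add_sub_right_comm, ← Finset.sum_sub_distrib]
    congr 1
    refine Finset.sum_congr rfl fun k _ => ?_
    ring
  rw [e1]
  exact (norm_add_le _ _).trans (add_le_add h2 h1)

lemma norm_phiCoeff_sub_le (k : ℕ) (hk : k < 112) :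
    ‖((phiCoeff k : ℚ) : ℂ) - (phiApprox k : ℂ) / 10 ^ 30‖ ≤ 6 / 10 ^ 30 := by
  have h := (Rat.cast_le (K := ℝ)).2 (abs_phiCoeff_sub_phiApprox_le k hk)
  push_cast at h
  have e : ((phiCoeff k : ℚ) : ℂ) - (phiApprox k : ℂ) / 10 ^ 30 =
      (((10 ^ 30 * ((phiCoeff k : ℚ) : ℝ) - phiApprox k) / 10 ^ 30 : ℝ) : ℂ) := by
    push_cast
    ring
  rw [e, Complex.norm_real, Real.norm_eq_abs, abs_div, abs_of_pos (by positivity : (0 : ℝ) < 10 ^ 30)]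
  gcongr

/-- The constant 334/1000 only has to work at indices 64 and 65, where the table decides it;
`phiCoeff_le_geometric` does the rest. At radius 3/2 the tail is then geometric with ratio 9/10. -/
lemma phiCoeff_tail_le (j : ℕ) :
    ((phiCoeff (j + 64) : ℚ) : ℝ) ≤ 334 / 1000 * (3 / 5) ^ (j + 64) := by
  have key : ∀ k, k < 112 → ((phiApprox k + 6) * 1000 * 5 ^ k ≤ 334 * 3 ^ k * 10 ^ 30) →
      phiCoeff k ≤ 334 / 1000 * (3 / 5) ^ k := by
    intro k hk h
    have h1 := (abs_le.1 (abs_phiCoeff_sub_phiApprox_le k hk)).2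
    have h2 : ((phiApprox k : ℚ) + 6) * 1000 * 5 ^ k ≤ 334 * 3 ^ k * 10 ^ 30 := by exact_mod_cast h
    rw [div_pow, ← mul_div_assoc, le_div_iff₀ (by positivity)]
    have h3 : 10 ^ 30 * phiCoeff k ≤ phiApprox k + 6 := by linarith
    have h4 := mul_le_mul_of_nonneg_right h3 (by positivity : (0 : ℚ) ≤ 5 ^ k)
    linarith
  have := phiCoeff_le_geometric (N := 64) (by norm_num)
    (key 64 (by norm_num) (by decide +kernel)) (key 65 (by norm_num) (by decide +kernel)) j
  rw [add_comm 64 j] at this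
  have h2 := (Rat.cast_le (K := ℝ)).2 this
  push_cast at h2
  exact h2

lemma norm_phi_sub_phiPoly_le {z : ℂ} (hz : ‖z‖ ≤ 3 / 2) :
    ‖phi z - phiPoly z / 10 ^ 30‖ ≤ 1 / 100 := by
  have hg : HasSum (fun j : ℕ => 334 / 1000 * (9 / 10) ^ 64 * (9 / 10 : ℝ) ^ j)
      (334 / 1000 * (9 / 10) ^ 64 * (1 - 9 / 10)⁻¹) :=
    (hasSum_geometric_of_lt_one (by norm_num) (by norm_num)).mul_left _
  have := norm_evalAt_sub_le (convergesOn_phiSeries ℂ) (q := phiApprox) (e := 6 / 10 ^ 30)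
    (fun k hk => by rw [coeff_phiSeries]; exact norm_phiCoeff_sub_le k (by omega)) hg
    (fun j => by
      rw [norm_coeff_phiSeries]
      calc ((phiCoeff (j + 64) : ℚ) : ℝ) * (3 / 2) ^ (j + 64)
          ≤ 334 / 1000 * (3 / 5) ^ (j + 64) * (3 / 2) ^ (j + 64) := by
            gcongr; exact phiCoeff_tail_le j
        _ = 334 / 1000 * (3 / 5 * (3 / 2)) ^ (j + 64) := by rw [mul_pow]; ring
        _ = 334 / 1000 * (9 / 10) ^ 64 * (9 / 10 : ℝ) ^ j := by
            rw [show (3 / 5 * (3 / 2) : ℝ) = 9 / 10 by norm_num, pow_add]; ring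
        _ ≤ _ := le_rfl) hz
  refine this.trans ?_
  rw [geom_sum_eq (by norm_num)]
  norm_num

lemma norm_phi'_sub_phiDerivPoly_le {z : ℂ} (hz : ‖z‖ ≤ 3 / 2) :
    ‖phi' z - phiDerivPoly z / 10 ^ 30‖ ≤ 9 / 50 := by
  have hg : HasSum (fun j : ℕ => 3 / 5 * (334 / 1000) * (9 / 10) ^ 64 *
      ((j : ℝ) * (9 / 10 : ℝ) ^ j + 65 * (9 / 10) ^ j))
      (3 / 5 * (334 / 1000) * (9 / 10) ^ 64 *
        (9 / 10 / (1 - 9 / 10) ^ 2 + 65 * (1 - 9 / 10)⁻¹)) :=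
    ((hasSum_coe_mul_geometric_of_norm_lt_one (by rw [Real.norm_eq_abs, abs_of_pos] <;> norm_num)).add
      ((hasSum_geometric_of_lt_one (by norm_num) (by norm_num)).mul_left _)).mul_left _
  have := norm_evalAt_sub_le (convergesOn_phiSeries ℂ).derivative (q := phiDerivApprox)
    (e := 64 * (6 / 10 ^ 30))
    (fun k hk => by
      rw [coeff_derivative, coeff_phiSeries, phiDerivApprox]
      have e : ((phiCoeff (k + 1) : ℚ) : ℂ) * ((k : ℂ) + 1) -
          (((k + 1) * phiApprox (k + 1) : ℕ) : ℂ) / 10 ^ 30 = ((k + 1 : ℕ) : ℂ) *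
          (((phiCoeff (k + 1) : ℚ) : ℂ) - (phiApprox (k + 1) : ℂ) / 10 ^ 30) := by
        push_cast; ring
      rw [e, norm_mul, Complex.norm_natCast]
      have hk' : ((k + 1 : ℕ) : ℝ) ≤ 64 := by exact_mod_cast hk
      gcongr
      exact norm_phiCoeff_sub_le (k + 1) (by omega)) hg
    (fun j => by
      rw [coeff_derivative, norm_mul, norm_coeff_phiSeries]
      have hn : ‖((j + 64 : ℕ) : ℂ) + 1‖ = (j : ℝ) + 65 := by
        have := Complex.norm_natCast (j + 65)
        push_cast at this ⊢
        rw [← this]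
        congr 1
        ring
      rw [hn]
      have ht := phiCoeff_tail_le (j + 1)
      rw [show j + 1 + 64 = j + 64 + 1 by ring] at ht
      calc ((phiCoeff (j + 64 + 1) : ℚ) : ℝ) * (j + 65) * (3 / 2) ^ (j + 64)
          ≤ 334 / 1000 * (3 / 5) ^ (j + 64 + 1) * (j + 65) * (3 / 2) ^ (j + 64) := by gcongr
        _ = 3 / 5 * (334 / 1000) * (j + 65) * (3 / 5 * (3 / 2)) ^ (j + 64) := by
            rw [mul_pow, pow_succ]; ring
        _ = 3 / 5 * (334 / 1000) * (9 / 10) ^ 64 *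
            ((j : ℝ) * (9 / 10 : ℝ) ^ j + 65 * (9 / 10) ^ j) := by
            rw [show (3 / 5 * (3 / 2) : ℝ) = 9 / 10 by norm_num, pow_add]; ring
        _ ≤ _ := le_rfl) hz
  refine this.trans ?_
  rw [geom_sum_eq (by norm_num)]
  norm_num

/-- The margins fit together: the test certifies 3.53 plus the Lipschitz variation over the piece,
truncation costs 1/100, and 3.52 = 88/25 remains. -/
lemma dist_of_bisect {s L : ℕ} (hs : s ≤ 48)
    (hL : ∑ k ∈ Finset.range 64, k * phiApprox k * s ^ (k - 1) * 32 ^ (64 - k) ≤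
      L * 10 ^ 30 * 32 ^ 63) {d x₀ y₀ x₁ y₁ : ℕ} (h : bisect (distTest L) d x₀ y₀ x₁ y₁ = true)
    (h0 : ‖gridPoint x₀ y₀‖ ≤ (s : ℝ) / 32) (h1 : ‖gridPoint x₁ y₁‖ ≤ (s : ℝ) / 32) {t : ℝ}
    (ht0 : 0 ≤ t) (ht1 : t ≤ 1) :
    88 / 25 ≤ ‖phi ((1 - (t : ℂ)) * gridPoint x₀ y₀ + t * gridPoint x₁ y₁) - 9 / 2‖ := by
  refine bisect_sound (P := fun z => 88 / 25 ≤ ‖phi z - 9 / 2‖) (fun w x y ht z hz hc hzc => ?_) d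
    x₀ y₀ x₁ y₁ h h0 h1 t ht0 ht1
  have hs' : (s : ℝ) / 32 ≤ 3 / 2 := by
    have : (s : ℝ) ≤ 48 := by exact_mod_cast hs
    linarith
  have a1 := distTest_sound ht
  have a2 := norm_sum_sub_sum_le phiApprox hL hz hc
  have a3 := norm_phi_sub_phiPoly_le (hz.trans hs')
  have a4 : ‖phiPoly z / 10 ^ 30 - phiPoly (gridPoint x y) / 10 ^ 30‖ ≤
      (L : ℝ) * (w / (2 * 65536)) := by
    rw [← sub_div, norm_div, div_le_iff₀ (by simp)]
    refine a2.trans ?_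
    have : ‖(10 : ℂ) ^ 30‖ = 10 ^ 30 := by simp
    rw [this]
    calc (L : ℝ) * 10 ^ 30 * ‖z - gridPoint x y‖ ≤ L * 10 ^ 30 * (w / (2 * 65536)) := by gcongr
      _ = _ := by ring
  have a5 : ‖phiPoly (gridPoint x y) / 10 ^ 30 - 9 / 2‖ ≤ ‖phi z - 9 / 2‖ +
      ‖phi z - phiPoly z / 10 ^ 30‖ +
      ‖phiPoly z / 10 ^ 30 - phiPoly (gridPoint x y) / 10 ^ 30‖ := by
    have e : phiPoly (gridPoint x y) / 10 ^ 30 - 9 / 2 = (phi z - 9 / 2) -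
      (phi z - phiPoly z / 10 ^ 30) -
      (phiPoly z / 10 ^ 30 - phiPoly (gridPoint x y) / 10 ^ 30) := by ring
    rw [e]
    exact (norm_sub_le _ _).trans (add_le_add_left (norm_sub_le _ _) _)
  linarith

/-- Here the test certifies 1/5 plus the Lipschitz variation, truncation costs 9/50, and 1/50
remains. -/
lemma deriv_of_bisect {s L : ℕ} (hs : s ≤ 48)
    (hL : ∑ k ∈ Finset.range 64, k * phiDerivApprox k * s ^ (k - 1) * 32 ^ (64 - k) ≤
      L * 10 ^ 30 * 32 ^ 63) {d x₀ y₀ x₁ y₁ : ℕ} (h : bisect (derivTest L) d x₀ y₀ x₁ y₁ = true)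
    (h0 : ‖gridPoint x₀ y₀‖ ≤ (s : ℝ) / 32) (h1 : ‖gridPoint x₁ y₁‖ ≤ (s : ℝ) / 32) {t : ℝ}
    (ht0 : 0 ≤ t) (ht1 : t ≤ 1) :
    1 / 50 ≤ (phi' ((1 - (t : ℂ)) * gridPoint x₀ y₀ + t * gridPoint x₁ y₁)).re := by
  refine bisect_sound (P := fun z => 1 / 50 ≤ (phi' z).re) (fun w x y ht z hz hc hzc => ?_) d
    x₀ y₀ x₁ y₁ h h0 h1 t ht0 ht1
  have hs' : (s : ℝ) / 32 ≤ 3 / 2 := by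
    have : (s : ℝ) ≤ 48 := by exact_mod_cast hs
    linarith
  have a1 := derivTest_sound ht
  have a2 := norm_sum_sub_sum_le phiDerivApprox hL hz hc
  have a3 := norm_phi'_sub_phiDerivPoly_le (hz.trans hs')
  have a4 : ‖phiDerivPoly z / 10 ^ 30 - phiDerivPoly (gridPoint x y) / 10 ^ 30‖ ≤
      (L : ℝ) * (w / (2 * 65536)) := by
    rw [← sub_div, norm_div, div_le_iff₀ (by simp)]
    refine a2.trans ?_
    have : ‖(10 : ℂ) ^ 30‖ = 10 ^ 30 := by simp
    rw [this]
    calc (L : ℝ) * 10 ^ 30 * ‖z - gridPoint x y‖ ≤ L * 10 ^ 30 * (w / (2 * 65536)) := by gcongr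
      _ = _ := by ring
  have a5 := (abs_le.1 (Complex.abs_re_le_norm (phi' z - phiDerivPoly z / 10 ^ 30))).1
  have a6 := (abs_le.1 (Complex.abs_re_le_norm
    (phiDerivPoly z / 10 ^ 30 - phiDerivPoly (gridPoint x y) / 10 ^ 30))).1
  rw [Complex.sub_re] at a5 a6
  linarith

/-- Radius 43/32 contains the left edge and the left half of the slanted edge; radius 48/32 = 3/2
contains the whole trapezoid. These four inequalities justify the constants 18, 53, 90 and 530 of
the bisection checks. -/
lemma phiApprox_lipschitz_left :
    ∑ k ∈ Finset.range 64, k * phiApprox k * 43 ^ (k - 1) * 32 ^ (64 - k) ≤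
      18 * 10 ^ 30 * 32 ^ 63 := by decide +kernel

lemma phiApprox_lipschitz :
    ∑ k ∈ Finset.range 64, k * phiApprox k * 48 ^ (k - 1) * 32 ^ (64 - k) ≤
      53 * 10 ^ 30 * 32 ^ 63 := by decide +kernel

lemma phiDerivApprox_lipschitz_left :
    ∑ k ∈ Finset.range 64, k * phiDerivApprox k * 43 ^ (k - 1) * 32 ^ (64 - k) ≤
      90 * 10 ^ 30 * 32 ^ 63 := by decide +kernel

lemma phiDerivApprox_lipschitz :
    ∑ k ∈ Finset.range 64, k * phiDerivApprox k * 48 ^ (k - 1) * 32 ^ (64 - k) ≤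
      530 * 10 ^ 30 * 32 ^ 63 := by decide +kernel

/-- A trapezoid that `φ` maps injectively onto a neighbourhood of the disc of centre `9 / 2` and
radius `7 / 2`. -/
def trapezoid : Set ℂ := {z | -1 / 8 < z.re ∧ z.re < 11 / 8 ∧ |z.im| < 5 / 4 - z.re / 2}

lemma isOpen_trapezoid : IsOpen trapezoid :=
  (isOpen_lt continuous_const Complex.continuous_re).inter
    ((isOpen_lt Complex.continuous_re continuous_const).inter
      (isOpen_lt Complex.continuous_im.abs
        (continuous_const.sub (Complex.continuous_re.div_const 2))))

lemma convex_trapezoid : Convex ℝ trapezoid := by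
  rintro z ⟨h1, h2, h3⟩ w ⟨h4, h5, h6⟩ a b ha hb hab
  rw [abs_lt] at h3 h6
  obtain rfl : a = 1 - b := by linarith
  have hb1 : b ≤ 1 := by linarith
  refine ⟨?_, ?_, ?_⟩
  · simp only [Complex.add_re, Complex.real_smul, Complex.re_ofReal_mul]
    rcases hb.eq_or_lt with rfl | hb
    · simpa using h1
    · nlinarith
  · simp only [Complex.add_re, Complex.real_smul, Complex.re_ofReal_mul]
    rcases hb.eq_or_lt with rfl | hb
    · simpa using h2
    · nlinarith
  · simp only [Complex.add_re, Complex.add_im, Complex.real_smul, Complex.re_ofReal_mul,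
      Complex.im_ofReal_mul]
    rw [abs_lt]
    rcases hb.eq_or_lt with rfl | hb
    · simpa using h3
    · constructor <;> nlinarith

lemma closure_trapezoid_subset {z : ℂ} (hz : z ∈ closure trapezoid) :
    -1 / 8 ≤ z.re ∧ z.re ≤ 11 / 8 ∧ |z.im| ≤ 5 / 4 - z.re / 2 := by
  have hc : IsClosed {z : ℂ | -1 / 8 ≤ z.re ∧ z.re ≤ 11 / 8 ∧ |z.im| ≤ 5 / 4 - z.re / 2} :=
    (isClosed_le continuous_const Complex.continuous_re).inter
      ((isClosed_le Complex.continuous_re continuous_const).inter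
        (isClosed_le Complex.continuous_im.abs
          (continuous_const.sub (Complex.continuous_re.div_const 2))))
  have hsub : trapezoid ⊆
      {z : ℂ | -1 / 8 ≤ z.re ∧ z.re ≤ 11 / 8 ∧ |z.im| ≤ 5 / 4 - z.re / 2} :=
    fun z hz => ⟨hz.1.le, hz.2.1.le, hz.2.2.le⟩
  exact closure_minimal hsub hc hz

lemma norm_le_of_mem_closure_trapezoid {z : ℂ} (hz : z ∈ closure trapezoid) : ‖z‖ ≤ 3 / 2 := by
  obtain ⟨h1, h2, h3⟩ := closure_trapezoid_subset hz
  rw [Complex.norm_def]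
  apply Real.sqrt_le_iff.2 ⟨by norm_num, ?_⟩
  rw [Complex.normSq_apply]
  have : z.im * z.im ≤ (5 / 4 - z.re / 2) * (5 / 4 - z.re / 2) := by
    rw [← abs_mul_abs_self z.im]
    exact mul_self_le_mul_self (abs_nonneg _) h3
  nlinarith

lemma isBounded_trapezoid : Bornology.IsBounded trapezoid :=
  (Metric.isBounded_closedBall (x := (0 : ℂ)) (r := 3 / 2)).subset fun z hz => by
    simpa using norm_le_of_mem_closure_trapezoid (subset_closure hz)

lemma norm_gridPoint_le {x y : ℕ} {r : ℝ} (hr : 0 ≤ r)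
    (h : ((x : ℝ) - 8192) ^ 2 + (y : ℝ) ^ 2 ≤ (65536 * r) ^ 2) : ‖gridPoint x y‖ ≤ r := by
  have e : gridPoint x y = ((((x : ℝ) - 8192) / 65536 : ℝ) : ℂ) +
      (((y : ℝ) / 65536 : ℝ) : ℂ) * Complex.I := by
    unfold gridPoint; push_cast; ring
  rw [e, Complex.norm_add_mul_I]
  apply Real.sqrt_le_iff.2 ⟨hr, ?_⟩
  nlinarith

lemma frontier_bounds_of_im_nonneg {z : ℂ} (hz : z ∈ frontier trapezoid) (him : 0 ≤ z.im) :
    88 / 25 ≤ ‖phi z - 9 / 2‖ ∧ 1 / 50 ≤ (phi' z).re := by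
  obtain ⟨h1, h2, h3⟩ := closure_trapezoid_subset (frontier_subset_closure hz)
  have hnot : z ∉ trapezoid := by
    rw [isOpen_trapezoid.frontier_eq] at hz
    exact hz.2
  rw [abs_of_nonneg him] at h3
  have hcase : z.re = -1 / 8 ∨ z.re = 11 / 8 ∨ z.im = 5 / 4 - z.re / 2 := by
    by_contra hcon
    push Not at hcon
    refine hnot ⟨lt_of_le_of_ne h1 (Ne.symm hcon.1), lt_of_le_of_ne h2 hcon.2.1, ?_⟩
    rw [abs_of_nonneg him]
    exact lt_of_le_of_ne h3 hcon.2.2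
  -- One certified segment: `t` is the position of z between its grid endpoints, and both bounds
  -- follow at once.
  have edge : ∀ {s L L' x₀ y₀ x₁ y₁ : ℕ} {t : ℝ}, s ≤ 48 →
      (∑ k ∈ Finset.range 64, k * phiApprox k * s ^ (k - 1) * 32 ^ (64 - k) ≤
        L * 10 ^ 30 * 32 ^ 63) →
      (∑ k ∈ Finset.range 64, k * phiDerivApprox k * s ^ (k - 1) * 32 ^ (64 - k) ≤
        L' * 10 ^ 30 * 32 ^ 63) →
      bisect (distTest L) 12 x₀ y₀ x₁ y₁ = true → bisect (derivTest L') 12 x₀ y₀ x₁ y₁ = true →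
      ((x₀ : ℝ) - 8192) ^ 2 + (y₀ : ℝ) ^ 2 ≤ (65536 * (s / 32)) ^ 2 →
      ((x₁ : ℝ) - 8192) ^ 2 + (y₁ : ℝ) ^ 2 ≤ (65536 * (s / 32)) ^ 2 → 0 ≤ t → t ≤ 1 →
      z.re * 65536 = (1 - t) * x₀ + t * x₁ - 8192 → z.im * 65536 = (1 - t) * y₀ + t * y₁ →
      88 / 25 ≤ ‖phi z - 9 / 2‖ ∧ 1 / 50 ≤ (phi' z).re := by
    intro s L L' x₀ y₀ x₁ y₁ t hs hL hL' hb hb' hn0 hn1 ht0 ht1 hre him'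
    have ez : z = (1 - (t : ℂ)) * gridPoint x₀ y₀ + t * gridPoint x₁ y₁ := by
      have hre' : (z.re : ℂ) * 65536 = (1 - t) * x₀ + t * x₁ - 8192 := by exact_mod_cast hre
      have him'' : (z.im : ℂ) * 65536 = (1 - t) * y₀ + t * y₁ := by exact_mod_cast him'
      conv_lhs => rw [← Complex.re_add_im z]
      unfold gridPoint
      linear_combination (1 / 65536 : ℂ) * hre' + (Complex.I / 65536) * him''
    have hr : (0 : ℝ) ≤ (s : ℝ) / 32 := by positivity
    rw [ez]
    exact ⟨dist_of_bisect hs hL hb (norm_gridPoint_le hr hn0) (norm_gridPoint_le hr hn1) ht0 ht1,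
      deriv_of_bisect hs hL' hb' (norm_gridPoint_le hr hn0) (norm_gridPoint_le hr hn1) ht0 ht1⟩
  rcases hcase with h | h | h
  · exact edge (t := z.im * (16 / 21)) (by norm_num) phiApprox_lipschitz_left
      phiDerivApprox_lipschitz_left bisect_distTest_left bisect_derivTest_left (by norm_num)
      (by norm_num) (by linarith) (by linarith) (by rw [h]; push_cast; ring) (by push_cast; ring)
  · exact edge (t := z.im * (16 / 9)) (by norm_num) phiApprox_lipschitz
      phiDerivApprox_lipschitz bisect_distTest_right bisect_derivTest_right (by norm_num)
      (by norm_num) (by linarith) (by linarith) (by rw [h]; push_cast; ring) (by push_cast; ring)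
  · rcases le_total z.re (5 / 8) with h' | h'
    · exact edge (t := (z.re + 1 / 8) * (4 / 3)) (by norm_num) phiApprox_lipschitz_left
        phiDerivApprox_lipschitz_left bisect_distTest_slanted_left bisect_derivTest_slanted_left
        (by norm_num) (by norm_num) (by linarith) (by linarith) (by push_cast; ring)
        (by rw [h]; push_cast; ring)
    · exact edge (t := (z.re - 5 / 8) * (4 / 3)) (by norm_num) phiApprox_lipschitz
        phiDerivApprox_lipschitz bisect_distTest_slanted_right bisect_derivTest_slanted_right
        (by norm_num) (by norm_num) (by linarith) (by linarith) (by push_cast; ring)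
        (by rw [h]; push_cast; ring)

lemma conj_mem_trapezoid {z : ℂ} (hz : z ∈ trapezoid) : starRingEnd ℂ z ∈ trapezoid := by
  simpa [trapezoid] using hz

/-- The coefficients of φ are real and the trapezoid is symmetric under conjugation, so the upper
half of the frontier suffices. -/
lemma frontier_bounds {z : ℂ} (hz : z ∈ frontier trapezoid) :
    88 / 25 ≤ ‖phi z - 9 / 2‖ ∧ 1 / 50 ≤ (phi' z).re := by
  rcases le_total 0 z.im with him | him
  · exact frontier_bounds_of_im_nonneg hz him
  · have hz' : starRingEnd ℂ z ∈ frontier trapezoid := by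
      rw [isOpen_trapezoid.frontier_eq] at hz ⊢
      refine ⟨?_, fun h => hz.2 (by simpa using conj_mem_trapezoid h)⟩
      exact map_mem_closure Complex.continuous_conj hz.1 fun w hw => conj_mem_trapezoid hw
    obtain ⟨h1, h2⟩ := frontier_bounds_of_im_nonneg hz' (by simpa using him)
    rw [phi_conj] at h1
    rw [phi'_conj, Complex.conj_re] at h2
    refine ⟨?_, h2⟩
    have e : starRingEnd ℂ (phi z) - 9 / 2 = starRingEnd ℂ (phi z - 9 / 2) := by
      have h9 : (9 / 2 : ℂ) = ((9 / 2 : ℝ) : ℂ) := by push_cast; ring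
      rw [map_sub, h9, Complex.conj_ofReal]
    rwa [e, RCLike.norm_conj] at h1

/-- Since |exp(-φ')| = exp(-Re φ'), the maximum modulus principle for exp(-φ') is a minimum
principle for Re φ', and the frontier bound 1/50 spreads to the interior. -/
lemma re_phi'_pos {z : ℂ} (hz : z ∈ closure trapezoid) : 0 < (phi' z).re := by
  have hd : DiffContOnCl ℂ (fun w => Complex.exp (-phi' w)) trapezoid := by
    refine DifferentiableOn.diffContOnCl fun w hw => ?_
    have hw' : ‖w‖ < 5 / 3 := (norm_le_of_mem_closure_trapezoid hw).trans_lt (by norm_num)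
    exact ((hasDerivAt_phi' hw').neg.cexp).differentiableAt.differentiableWithinAt
  have := Complex.norm_le_of_forall_mem_frontier_norm_le isBounded_trapezoid hd
    (C := Real.exp (-(1 / 50))) (fun w hw => by
      rw [Complex.norm_exp, Complex.neg_re]
      exact Real.exp_le_exp.2 (neg_le_neg (frontier_bounds hw).2)) hz
  rw [Complex.norm_exp, Complex.neg_re, Real.exp_le_exp] at this
  linarith

end FrontierBounds

/-! ### Inverting φ holomorphically on a disc about 9/2. -/

section HolomorphicInverse

/-- A holomorphic function on a convex open set whose derivative has positive real part is
injective. -/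
lemma injOn_of_re_deriv_pos {Ω : Set ℂ} (hconv : Convex ℝ Ω) {f f' : ℂ → ℂ}
    (hf : ∀ z ∈ Ω, HasDerivAt f (f' z) z) (hre : ∀ z ∈ Ω, 0 < (f' z).re) : Set.InjOn f Ω := by
  intro a ha b hb hab
  by_contra hne
  have hmem : ∀ t ∈ Set.Icc (0 : ℝ) 1, a + (t : ℂ) * (b - a) ∈ Ω := by
    intro t ht
    have := hconv ha hb (sub_nonneg.2 ht.2) ht.1 (sub_add_cancel 1 t)
    convert this using 1
    simp only [Complex.real_smul]
    push_cast
    ring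
  -- Along the segment from a to b, the component of f in the direction b - a has derivative Re f' ·
  -- |b - a|² > 0; by the mean value theorem it cannot return to its initial value.
  have hder : ∀ t ∈ Set.Icc (0 : ℝ) 1,
      HasDerivAt (fun t : ℝ => (f (a + (t : ℂ) * (b - a)) * starRingEnd ℂ (b - a)).re)
        ((f' (a + (t : ℂ) * (b - a)) * (b - a) * starRingEnd ℂ (b - a)).re) t := by
    intro t ht
    have h1 : HasDerivAt (fun s : ℂ => a + s * (b - a)) (b - a) (t : ℂ) := by
      simpa using ((hasDerivAt_id (t : ℂ)).mul_const (b - a)).const_add a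
    have h2 : HasDerivAt (fun s : ℂ => f (a + s * (b - a)) * starRingEnd ℂ (b - a))
        (f' (a + (t : ℂ) * (b - a)) * (b - a) * starRingEnd ℂ (b - a)) (t : ℂ) :=
      (HasDerivAt.comp (t : ℂ) (hf _ (hmem t ht)) h1).mul_const _
    exact h2.real_of_complex
  obtain ⟨c, hc, hc'⟩ := exists_hasDerivAt_eq_slope _ _ (zero_lt_one' ℝ)
    (fun t ht => (hder t ht).continuousAt.continuousWithinAt)
    (fun t ht => hder t (Set.Ioo_subset_Icc_self ht))
  have hpos : 0 < (f' (a + (c : ℂ) * (b - a)) * (b - a) * starRingEnd ℂ (b - a)).re := by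
    rw [mul_assoc, Complex.mul_conj, Complex.re_mul_ofReal]
    exact mul_pos (hre _ (hmem c (Set.Ioo_subset_Icc_self hc)))
      (Complex.normSq_pos.2 (sub_ne_zero.2 (Ne.symm hne)))
  rw [hc'] at hpos
  simp [hab] at hpos

/-- If moreover `f` stays at distance at least `R` from `p` on the frontier, then `f` has a
holomorphic right inverse on the ball of centre `p` and radius `R`. -/
theorem exists_holomorphic_rightInverse {Ω : Set ℂ} (hopen : IsOpen Ω) (hconv : Convex ℝ Ω)
    (hbdd : Bornology.IsBounded Ω) {f f' : ℂ → ℂ} (hf : ∀ z ∈ closure Ω, HasDerivAt f (f' z) z)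
    (hre : ∀ z ∈ Ω, 0 < (f' z).re) {p : ℂ} {R : ℝ} (hfr : ∀ z ∈ frontier Ω, R ≤ ‖f z - p‖)
    {z₀ : ℂ} (hz₀ : z₀ ∈ Ω) (hz₀p : f z₀ ∈ Metric.ball p R) :
    ∃ g : ℂ → ℂ, (∀ w ∈ Metric.ball p R, g w ∈ Ω ∧ f (g w) = w) ∧
      DifferentiableOn ℂ g (Metric.ball p R) := by
  have hinj := injOn_of_re_deriv_pos hconv (fun z hz => hf z (subset_closure hz)) hre
  have hdiff : DifferentiableOn ℂ f Ω :=
    fun z hz => (hf z (subset_closure hz)).differentiableAt.differentiableWithinAt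
  have hne : ∀ z ∈ Ω, f' z ≠ 0 := fun z hz h => by
    have := hre z hz
    rw [h] at this
    simp at this
  have hmap : ∀ z ∈ Ω, Filter.map f (nhds z) = nhds (f z) := by
    intro z hz
    have han := hdiff.analyticAt (hopen.mem_nhds hz)
    have hs := han.hasStrictDerivAt
    rw [(hf z (subset_closure hz)).deriv] at hs
    exact hs.map_nhds_eq (hne z hz)
  have himopen : IsOpen (f '' Ω) := by
    rw [isOpen_iff_mem_nhds]
    rintro _ ⟨z, hz, rfl⟩
    rw [← hmap z hz]
    exact Filter.image_mem_map (hopen.mem_nhds hz)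
  have hcompact : IsCompact (closure Ω) := hbdd.isCompact_closure
  -- The image is open, and closed relative to the ball because a limit point comes from the compact
  -- closure and cannot come from the frontier. The ball is connected and meets the image, so it
  -- lies in the image.
  have hsub : Metric.ball p R ⊆ f '' Ω := by
    refine (convex_ball p R).isPreconnected.subset_of_closure_inter_subset himopen
      ⟨f z₀, hz₀p, z₀, hz₀, rfl⟩ ?_
    rintro w ⟨hw, hwR⟩
    have hcl : IsClosed (f '' closure Ω) :=
      (hcompact.image_of_continuousOn
        fun z hz => (hf z hz).continuousAt.continuousWithinAt).isClosed
    obtain ⟨z, hz, rfl⟩ := closure_minimal (Set.image_mono subset_closure) hcl hw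
    by_cases hzΩ : z ∈ Ω
    · exact ⟨z, hzΩ, rfl⟩
    · have hzf : z ∈ frontier Ω := by
        rw [hopen.frontier_eq]; exact ⟨hz, hzΩ⟩
      have := hfr z hzf
      rw [Metric.mem_ball, dist_eq_norm] at hwR
      linarith
  have hex : ∀ w ∈ Metric.ball p R, ∃ z, z ∈ Ω ∧ f z = w := fun w hw => hsub hw
  choose! g hg using hex
  refine ⟨g, hg, fun w hw => ?_⟩
  obtain ⟨hgΩ, hfg⟩ := hg w hw
  -- Injectivity identifies g with the local inverse, and openness of f makes that inverse
  -- continuous.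
  have hcont : ContinuousAt g w := by
    intro V hV
    have hV' : V ∩ Ω ∈ nhds (g w) := Filter.inter_mem hV (hopen.mem_nhds hgΩ)
    have h1 : f '' (V ∩ Ω) ∈ nhds w := by
      have := Filter.image_mem_map (m := f) hV'
      rwa [hmap _ hgΩ, hfg] at this
    change ∀ᶠ v in nhds w, g v ∈ V
    filter_upwards [h1, Metric.isOpen_ball.mem_nhds hw] with v hv hvR
    obtain ⟨z, ⟨hzV, hzΩ⟩, rfl⟩ := hv
    obtain ⟨h2, h3⟩ := hg _ hvR
    rw [hinj h2 hzΩ h3]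
    exact hzV
  have := HasDerivAt.of_local_left_inverse hcont (hf _ (subset_closure hgΩ)) (hne _ hgΩ)
    (Filter.eventually_of_mem (Metric.isOpen_ball.mem_nhds hw) fun v hv => (hg v hv).2)
  exact this.differentiableAt.differentiableWithinAt

lemma hasDerivAt_phi_of_mem_closure {z : ℂ} (hz : z ∈ closure trapezoid) :
    HasDerivAt phi (phi' z) z :=
  hasDerivAt_phi ((norm_le_of_mem_closure_trapezoid hz).trans_lt (by norm_num))

lemma injOn_phi : Set.InjOn (phi : ℂ → ℂ) trapezoid :=
  injOn_of_re_deriv_pos convex_trapezoid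
    (fun _ hz => hasDerivAt_phi_of_mem_closure (subset_closure hz))
    (fun _ hz => re_phi'_pos (subset_closure hz))

/-- The analytic function `F` with `φ(1 - F(x)) = 9 / 2 * (1 - x)`. -/
theorem exists_powerSeries_solution : ∃ c : PowerSeries ℝ, ConvergesOn c (176 / 225) ∧
    ∀ x : ℝ, |x| < 176 / 225 → ((1 - evalAt c x : ℝ) : ℂ) ∈ trapezoid ∧
      phi (1 - evalAt c x) = 9 / 2 * (1 - x) := by
  have h1mem : (1 : ℂ) ∈ trapezoid := by
    refine ⟨?_, ?_, ?_⟩ <;> norm_num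
  have hphi1 : phi (1 : ℂ) = 9 / 2 := by
    have := phi_ofReal 1 (by norm_num)
    rw [phi_one] at this
    push_cast at this
    exact this
  -- Radius 88/25 in the values of φ is radius (88/25)/(9/2) = 176/225 in x, which just exceeds 7/9
  -- = 175/225.
  obtain ⟨g, hg, hgd⟩ := exists_holomorphic_rightInverse isOpen_trapezoid convex_trapezoid
    isBounded_trapezoid (fun z hz => hasDerivAt_phi_of_mem_closure hz)
    (fun z hz => re_phi'_pos (subset_closure hz)) (p := 9 / 2) (R := 88 / 25)
    (fun z hz => (frontier_bounds hz).1) h1mem (by rw [hphi1]; simp)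
  let h : ℂ → ℂ := fun w => 1 - g (9 / 2 * (1 - w))
  have hmaps : ∀ w ∈ Metric.ball (0 : ℂ) (176 / 225),
      (9 / 2 * (1 - w) : ℂ) ∈ Metric.ball (9 / 2 : ℂ) (88 / 25) := by
    intro w hw
    rw [mem_ball_zero_iff] at hw
    rw [Metric.mem_ball, dist_eq_norm]
    have e : (9 / 2 * (1 - w) - 9 / 2 : ℂ) = -(9 / 2 : ℝ) * w := by push_cast; ring
    rw [e, norm_mul, norm_neg, Complex.norm_of_nonneg (by norm_num)]
    linarith
  have hh : DifferentiableOn ℂ h (Metric.ball 0 (176 / 225)) := by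
    refine (differentiableOn_const 1).sub (hgd.comp ?_ hmaps)
    fun_prop
  let d : ℕ → ℂ := fun n => ((n.factorial : ℂ))⁻¹ * iteratedDeriv n h 0
  have hsum : ∀ w : ℂ, ‖w‖ < 176 / 225 → HasSum (fun n => d n * w ^ n) (h w) := by
    intro w hw
    refine (Complex.hasSum_taylorSeries_on_ball hh (z := w) (by simpa using hw)).congr_fun ?_
    intro n
    simp only [d, smul_eq_mul, sub_zero]
    ring
  have hconv : ConvergesOn (PowerSeries.mk fun n => (d n).re) (176 / 225) := by
    intro ρ h0 hρ
    have hs := (hsum (ρ : ℂ) (by rwa [Complex.norm_of_nonneg h0])).summable.norm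
    refine Summable.of_nonneg_of_le (fun n => by positivity) (fun n => ?_) hs
    rw [PowerSeries.coeff_mk, norm_mul, norm_pow, Complex.norm_of_nonneg h0, Real.norm_eq_abs]
    gcongr
    exact Complex.abs_re_le_norm _
  refine ⟨PowerSeries.mk fun n => (d n).re, hconv, fun x hx => ?_⟩
  have hx' : ‖(x : ℂ)‖ < 176 / 225 := by rwa [Complex.norm_real, Real.norm_eq_abs]
  have hre : evalAt (PowerSeries.mk fun n => (d n).re) x = (h x).re := by
    have h2 := Complex.hasSum_re (hsum x hx')
    refine (h2.congr_fun ?_).tsum_eq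
    intro n
    rw [PowerSeries.coeff_mk, ← Complex.ofReal_pow, Complex.re_mul_ofReal]
  obtain ⟨hu, hfu⟩ := hg _ (hmaps x (by simpa using hx'))
  -- A preimage of a real value and its conjugate both lie in the trapezoid and have the same image,
  -- so they coincide. Hence the inverse is real on the real axis, and the real parts of the Taylor
  -- coefficients suffice there.
  have hureal : starRingEnd ℂ (g (9 / 2 * (1 - x))) = g (9 / 2 * (1 - x)) := by
    refine injOn_phi (conj_mem_trapezoid hu) hu ?_
    rw [phi_conj, hfu]
    have e : (9 / 2 * (1 - x) : ℂ) = ((9 / 2 * (1 - x) : ℝ) : ℂ) := by push_cast; ring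
    rw [e, Complex.conj_ofReal]
  have hu' : ((1 - evalAt (PowerSeries.mk fun n => (d n).re) x : ℝ) : ℂ) = g (9 / 2 * (1 - x)) := by
    rw [hre]
    have : (1 - (h x).re : ℝ) = (g (9 / 2 * (1 - x))).re := by
      simp [h]
    rw [this]
    exact Complex.conj_eq_iff_re.1 hureal
  rw [← hu'] at hu hfu
  refine ⟨hu, ?_⟩
  have hn := (norm_le_of_mem_closure_trapezoid (subset_closure hu)).trans_lt
    (by norm_num : (3 / 2 : ℝ) < 5 / 3)
  rw [Complex.norm_real] at hn
  rw [phi_ofReal _ hn] at hfu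
  have e : (9 / 2 * (1 - x) : ℂ) = ((9 / 2 * (1 - x) : ℝ) : ℂ) := by push_cast; ring
  rw [e] at hfu
  exact Complex.ofReal_injective hfu

end HolomorphicInverse

/-! ### The analytic function F: boundary values, monotonicity, differential equation. -/

section EquilibriumFunction

open PowerSeries

/-- The power series of the equilibrium distribution function. -/
noncomputable def eqSeries : PowerSeries ℝ := Classical.choose exists_powerSeries_solution

/-- The analytic function that is the equilibrium distribution function on `[0, 7 / 9]`. -/
noncomputable def eqFun (x : ℝ) : ℝ := evalAt eqSeries x

/-- The derivative of `eqFun`. -/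
noncomputable def eqFun' (x : ℝ) : ℝ := evalAt (d⁄dX ℝ eqSeries) x

/-- The second derivative of `eqFun`. -/
noncomputable def eqFun'' (x : ℝ) : ℝ := evalAt (d⁄dX ℝ (d⁄dX ℝ eqSeries)) x

lemma convergesOn_eqSeries : ConvergesOn eqSeries (176 / 225) :=
  (Classical.choose_spec exists_powerSeries_solution).1

variable {x : ℝ}

lemma eqFun_mem (hx : |x| < 176 / 225) : ((1 - eqFun x : ℝ) : ℂ) ∈ trapezoid :=
  ((Classical.choose_spec exists_powerSeries_solution).2 x hx).1

lemma phi_one_sub_eqFun (hx : |x| < 176 / 225) : phi (1 - eqFun x) = 9 / 2 * (1 - x) :=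
  ((Classical.choose_spec exists_powerSeries_solution).2 x hx).2

lemma abs_lt_of_mem_trapezoid {u : ℝ} (hu : (u : ℂ) ∈ trapezoid) : |u| < 5 / 3 := by
  have := (norm_le_of_mem_closure_trapezoid (subset_closure hu)).trans_lt
    (by norm_num : (3 / 2 : ℝ) < 5 / 3)
  rwa [Complex.norm_real] at this

lemma phi'_pos_of_mem {u : ℝ} (hu : (u : ℂ) ∈ trapezoid) : 0 < phi' u := by
  have := re_phi'_pos (subset_closure hu)
  rwa [phi'_ofReal u (abs_lt_of_mem_trapezoid hu), Complex.ofReal_re] at this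

lemma eq_of_phi_eq {u v : ℝ} (hu : (u : ℂ) ∈ trapezoid) (hv : (v : ℂ) ∈ trapezoid)
    (h : phi u = phi v) : u = v := by
  have := injOn_phi hu hv (by
    rw [phi_ofReal u (abs_lt_of_mem_trapezoid hu), phi_ofReal v (abs_lt_of_mem_trapezoid hv), h])
  exact_mod_cast this

lemma ofReal_mem_trapezoid {u : ℝ} (h0 : 0 ≤ u) (h1 : u ≤ 1) : (u : ℂ) ∈ trapezoid := by
  refine ⟨?_, ?_, ?_⟩ <;> simp <;> linarith

lemma hasDerivAt_eqFun (hx : |x| < 176 / 225) : HasDerivAt eqFun (eqFun' x) x :=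
  convergesOn_eqSeries.hasDerivAt hx

lemma hasDerivAt_eqFun' (hx : |x| < 176 / 225) : HasDerivAt eqFun' (eqFun'' x) x :=
  convergesOn_eqSeries.derivative.hasDerivAt hx

lemma eventually_abs_lt (hx : |x| < 176 / 225) : ∀ᶠ t in nhds x, |t| < 176 / 225 :=
  (continuous_abs.tendsto x).eventually (gt_mem_nhds hx)

lemma phi'_mul_eqFun' (hx : |x| < 176 / 225) : phi' (1 - eqFun x) * eqFun' x = 9 / 2 := by
  have hu := abs_lt_of_mem_trapezoid (eqFun_mem hx)
  have h1 : HasDerivAt (fun t => phi (1 - eqFun t)) (phi' (1 - eqFun x) * (-eqFun' x)) x :=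
    (hasDerivAt_phi (z := 1 - eqFun x) hu).comp x ((hasDerivAt_eqFun hx).const_sub 1)
  have h2 : HasDerivAt (fun t : ℝ => 9 / 2 * (1 - t)) (9 / 2 * (-1)) x :=
    ((hasDerivAt_id x).const_sub 1).const_mul _
  have h3 := h1.unique (h2.congr_of_eventuallyEq
    ((eventually_abs_lt hx).mono fun t ht => phi_one_sub_eqFun ht))
  linarith

lemma eqFun'_pos (hx : |x| < 176 / 225) : 0 < eqFun' x := by
  have h1 := phi'_mul_eqFun' hx
  have h2 := phi'_pos_of_mem (eqFun_mem hx)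
  by_contra h
  push Not at h
  nlinarith

lemma phi''_mul_eqFun' (hx : |x| < 176 / 225) :
    phi' (1 - eqFun x) * eqFun'' x = phi'' (1 - eqFun x) * eqFun' x ^ 2 := by
  have hu := abs_lt_of_mem_trapezoid (eqFun_mem hx)
  have h1 : HasDerivAt (fun t => phi' (1 - eqFun t)) (phi'' (1 - eqFun x) * (-eqFun' x)) x :=
    (hasDerivAt_phi' (z := 1 - eqFun x) hu).comp x ((hasDerivAt_eqFun hx).const_sub 1)
  have h2 := h1.mul (hasDerivAt_eqFun' hx)
  have h3 := h2.unique ((hasDerivAt_const x (9 / 2 : ℝ)).congr_of_eventuallyEq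
    ((eventually_abs_lt hx).mono fun t ht => phi'_mul_eqFun' ht))
  linarith

/-- With u = 1 - F one has 3 - u² = 2 + 2F - F² and 6 + 2u = 8 - 2F. The equation for φ at u is
combined with the once and twice differentiated defining relation, and the positive factor φ'(u) is
cancelled. -/
lemma eqFun_ode (hx : |x| < 176 / 225) :
    (2 + 2 * eqFun x - eqFun x * eqFun x) * eqFun'' x =
      eqFun' x * eqFun' x * (8 - 2 * eqFun x - 6 * (1 - x) * eqFun' x) := by
  have hu := abs_lt_of_mem_trapezoid (eqFun_mem hx)
  have h0 := phi_one_sub_eqFun hx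
  have h1 := phi'_mul_eqFun' hx
  have h2 := phi''_mul_eqFun' hx
  have h3 := phi_ode (z := 1 - eqFun x) hu
  have hp := phi'_pos_of_mem (eqFun_mem hx)
  generalize phi (1 - eqFun x) = p at *
  generalize phi' (1 - eqFun x) = q at *
  generalize phi'' (1 - eqFun x) = r at *
  have hq : q ≠ 0 := hp.ne'
  refine mul_left_cancel₀ hq ?_
  generalize eqFun x = f at *
  generalize eqFun' x = g at *
  subst h0
  linear_combination (2 + 2 * f - f * f) * h2 + g ^ 2 * h3 + (6 * (1 - x) * g ^ 2) * h1

lemma eqFun_zero : eqFun 0 = 0 := by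
  have hx : |(0 : ℝ)| < 176 / 225 := by norm_num
  have h := phi_one_sub_eqFun hx
  have := eq_of_phi_eq (eqFun_mem hx) (v := 1) (ofReal_mem_trapezoid (by norm_num) le_rfl)
    (by rw [h, phi_one]; norm_num)
  linarith

lemma eqFun_seven_ninths : eqFun (7 / 9) = 1 := by
  have hx : |(7 / 9 : ℝ)| < 176 / 225 := by rw [abs_of_pos] <;> norm_num
  have h := phi_one_sub_eqFun hx
  have := eq_of_phi_eq (eqFun_mem hx) (v := 0) (ofReal_mem_trapezoid le_rfl (by norm_num))
    (by rw [h, phi_zero]; norm_num)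
  linarith

lemma eqFun'_zero : eqFun' 0 * phi' (1 : ℝ) = 9 / 2 := by
  have := phi'_mul_eqFun' (x := 0) (by norm_num)
  rw [eqFun_zero, sub_zero] at this
  linarith

lemma eqFun'_seven_ninths : eqFun' (7 / 9) = 9 / 4 := by
  have := phi'_mul_eqFun' (x := 7 / 9) (by rw [abs_of_pos] <;> norm_num)
  rw [eqFun_seven_ninths, sub_self, phi'_zero] at this
  linarith

lemma abs_lt_of_mem_Icc (hx : x ∈ Set.Icc (0 : ℝ) (7 / 9)) : |x| < 176 / 225 := by
  rw [abs_of_nonneg hx.1]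
  linarith [hx.2]

lemma monotoneOn_eqFun : MonotoneOn eqFun (Set.Icc 0 (7 / 9)) := by
  refine monotoneOn_of_deriv_nonneg (convex_Icc _ _)
    (fun x hx => (hasDerivAt_eqFun (abs_lt_of_mem_Icc hx)).continuousAt.continuousWithinAt)
    (fun x hx => ?_) fun x hx => ?_
  · exact (hasDerivAt_eqFun (abs_lt_of_mem_Icc
      (interior_subset hx))).differentiableAt.differentiableWithinAt
  · have hx' := abs_lt_of_mem_Icc (interior_subset hx)
    rw [(hasDerivAt_eqFun hx').deriv]
    exact (eqFun'_pos hx').le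

/-- The differential equation as an identity of formal power series. -/
lemma eqSeries_ode : (C 2 + C 2 * eqSeries - eqSeries * eqSeries) * d⁄dX ℝ (d⁄dX ℝ eqSeries) =
    d⁄dX ℝ eqSeries * d⁄dX ℝ eqSeries *
      (C 8 - C 2 * eqSeries - C 6 * (C 1 - X) * d⁄dX ℝ eqSeries) := by
  have h0 := convergesOn_eqSeries
  have h1 := h0.derivative
  have h2 := h1.derivative
  have hX := convergesOn_X (𝕜 := ℝ) (176 / 225)
  have hC := fun a => convergesOn_C (𝕜 := ℝ) a (176 / 225)
  have a1 := (hC 2).add ((hC 2).mul h0)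
  have a2 := a1.sub (h0.mul h0)
  have b1 := (hC 8).sub ((hC 2).mul h0)
  have b2 := (hC 6).mul ((hC 1).sub hX)
  have b3 := b1.sub (b2.mul h1)
  refine (a2.mul h2).eq_of_eventually ((h1.mul h1).mul b3) (by norm_num) ?_
  filter_upwards [eventually_abs_lt (x := 0) (by norm_num)] with x hx
  rw [a2.evalAt_mul h2 hx, a1.evalAt_sub (h0.mul h0) hx, (hC 2).evalAt_add ((hC 2).mul h0) hx,
    (hC 2).evalAt_mul h0 hx, h0.evalAt_mul h0 hx, (h1.mul h1).evalAt_mul b3 hx,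
    h1.evalAt_mul h1 hx, b1.evalAt_sub (b2.mul h1) hx, (hC 8).evalAt_sub ((hC 2).mul h0) hx,
    (hC 2).evalAt_mul h0 hx, b2.evalAt_mul h1 hx, (hC 6).evalAt_mul ((hC 1).sub hX) hx,
    (hC 1).evalAt_sub hX hx]
  simp only [evalAt_C, evalAt_X]
  exact eqFun_ode hx

end EquilibriumFunction

/-! ### Numerical values of the Taylor coefficients of F. -/

section Coefficients

open PowerSeries

set_option maxHeartbeats 1000000 in
/-- The coefficients `2, …, 12` as polynomials in the first one. -/
lemma coeff_polynomials {c q A r : ℕ → ℝ} (a : ℝ) (h0 : c 0 = 0) (h1 : c 1 = a)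
    (hA : ∀ n, A n = ∑ i ∈ Finset.range (n + 1), c i * c (n - i))
    (hq : ∀ n, q n = ∑ i ∈ Finset.range (n + 1),
      (((i : ℝ) + 1) * c (i + 1)) * ((((n - i : ℕ) : ℝ) + 1) * c (n - i + 1)))
    (hr : ∀ n, r n = ∑ i ∈ Finset.range (n + 1), q i * ((((n - i : ℕ) : ℝ) + 1) * c (n - i + 1)))
    (hz : 2 * (2 * c 2) = 8 * q 0 - 6 * r 0)
    (hn : ∀ n : ℕ, 2 * (((n : ℝ) + 3) * (n + 2) * c (n + 3)) +
      ∑ i ∈ Finset.range (n + 2), (2 * c i - A i) *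
        ((((n + 1 - i : ℕ) : ℝ) + 2) * (((n + 1 - i : ℕ) : ℝ) + 1) * c (n + 1 - i + 2)) =
      8 * q (n + 1) - 2 * ∑ i ∈ Finset.range (n + 2), c i * q (n + 1 - i)
        - 6 * r (n + 1) + 6 * r n) :
    c 2 = a ^ 2 * (2 - 3/2 * a) ∧
    c 3 = a ^ 3 * (5 - 19/2 * a + 9/2 * a ^ 2) ∧
    c 4 = a ^ 4 * (29/2 - 185/4 * a + 195/4 * a ^ 2 - 135/8 * a ^ 3) ∧
    c 5 = a ^ 5 * (185/4 - 1671/8 * a + 1407/4 * a ^ 2 - 2079/8 * a ^ 3 + 567/8 * a ^ 4) ∧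
    c 6 = a ^ 6 * (3141/20 - 3677/4 * a + 34349/16 * a ^ 2 - 9933/4 * a ^ 3 + 2835/2 * a ^ 4 -
      5103/16 * a ^ 5) ∧
    c 7 = a ^ 7 * (11139/20 - 160289/40 * a + 24015/2 * a ^ 2 - 152535/8 * a ^ 3 + 134865/8 * a ^
      4 - 125631/16 * a ^ 5 + 24057/16 * a ^ 6) ∧
    c 8 = a ^ 8 * (114171/56 - 2437461/140 * a + 2040507/32 * a ^ 2 - 4134615/32 * a ^ 3 +
      9976725/64 * a ^ 4 - 7150275/64 * a ^ 5 + 2814669/64 * a ^ 6 - 938223/128 * a ^ 7) ∧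
    c 9 = a ^ 9 * (8563103/1120 - 33863951/448 * a + 146680739/448 * a ^ 2 - 3233131/4 * a ^ 3 +
      79364065/64 * a ^ 4 - 154618893/128 * a ^ 5 + 46621575/64 * a ^ 6 - 31795335/128 * a ^ 7 +
      4691115/128 * a ^ 8) ∧
    c 10 = a ^ 10 * (3272929/112 - 735432709/2240 * a + 7357755669/4480 * a ^ 2 -
      10718827603/2240 * a ^ 3 + 1428065353/160 * a ^ 4 - 176465289/16 * a ^ 5 + 2307754449/256 *
      a ^ 6 - 150219927/32 * a ^ 7 + 90382149/64 * a ^ 8 - 47849373/256 * a ^ 9) ∧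
    c 11 = a ^ 11 * (635159557/5600 - 3197336823/2240 * a + 18143312469/2240 * a ^ 2 -
      121928028157/4480 * a ^ 3 + 7658309451/128 * a ^ 4 - 57437459079/640 * a ^ 5 + 371540169/4
      * a ^ 6 - 4186990197/64 * a ^ 7 + 3838099707/128 * a ^ 8 - 2066222925/256 * a ^ 9 +
      247946751/256 * a ^ 10) ∧
    c 12 = a ^ 12 * (2496658021/5600 - 139167607683/22400 * a + 353354615393/8960 * a ^ 2 -
      19221283653/128 * a ^ 3 + 194742331147/512 * a ^ 4 - 214963495123/320 * a ^ 5 +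
      539504615013/640 * a ^ 6 - 96098385825/128 * a ^ 7 + 29738304765/64 * a ^ 8 -
      97387973865/512 * a ^ 9 + 23720239179/512 * a ^ 10 - 5206881771/1024 * a ^ 11) := by
  -- Each coefficient of the equation is linear in the newest unknown: c (n + 3) enters with factor
  -- 2(n + 3)(n + 2), the divisor 12, 24, 40, … in the steps below.
  have c2 : c 2 = a ^ 2 * (2 - 3/2 * a) := by
    simp only [Finset.sum_range_succ, Finset.sum_range_zero, Nat.reduceSub, zero_add,
      hr, hq, h1] at hz
    push_cast at hz
    linear_combination hz / 4
  have c3 : c 3 = a ^ 3 * (5 - 19/2 * a + 9/2 * a ^ 2) := by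
    have e := hn 0
    simp only [Finset.sum_range_succ, Finset.sum_range_zero, Nat.reduceAdd, Nat.reduceSub, zero_add,
      hr, hq, hA, h0, h1, c2] at e
    push_cast at e
    linear_combination e / 12
  have c4 : c 4 = a ^ 4 * (29/2 - 185/4 * a + 195/4 * a ^ 2 - 135/8 * a ^ 3) := by
    have e := hn 1
    simp only [Finset.sum_range_succ, Finset.sum_range_zero, Nat.reduceAdd, Nat.reduceSub, zero_add,
      hr, hq, hA, h0, h1, c2, c3] at e
    push_cast at e
    linear_combination e / 24
  have c5 : c 5 = a ^ 5 * (185/4 - 1671/8 * a + 1407/4 * a ^ 2 - 2079/8 * a ^ 3 + 567/8 * a ^ 4)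
    := by
    have e := hn 2
    simp only [Finset.sum_range_succ, Finset.sum_range_zero, Nat.reduceAdd, Nat.reduceSub, zero_add,
      hr, hq, hA, h0, h1, c2, c3, c4] at e
    push_cast at e
    linear_combination e / 40
  have c6 : c 6 = a ^ 6 * (3141/20 - 3677/4 * a + 34349/16 * a ^ 2 - 9933/4 * a ^ 3 + 2835/2 * a
    ^ 4 - 5103/16 * a ^ 5) := by
    have e := hn 3
    simp only [Finset.sum_range_succ, Finset.sum_range_zero, Nat.reduceAdd, Nat.reduceSub, zero_add,
      hr, hq, hA, h0, h1, c2, c3, c4, c5] at e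
    push_cast at e
    linear_combination e / 60
  have c7 : c 7 = a ^ 7 * (11139/20 - 160289/40 * a + 24015/2 * a ^ 2 - 152535/8 * a ^ 3 +
    134865/8 * a ^ 4 - 125631/16 * a ^ 5 + 24057/16 * a ^ 6) := by
    have e := hn 4
    simp only [Finset.sum_range_succ, Finset.sum_range_zero, Nat.reduceAdd, Nat.reduceSub, zero_add,
      hr, hq, hA, h0, h1, c2, c3, c4, c5, c6] at e
    push_cast at e
    linear_combination e / 84
  have c8 : c 8 = a ^ 8 * (114171/56 - 2437461/140 * a + 2040507/32 * a ^ 2 - 4134615/32 * a ^ 3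
    + 9976725/64 * a ^ 4 - 7150275/64 * a ^ 5 + 2814669/64 * a ^ 6 - 938223/128 * a ^ 7) := by
    have e := hn 5
    simp only [Finset.sum_range_succ, Finset.sum_range_zero, Nat.reduceAdd, Nat.reduceSub, zero_add,
      hr, hq, hA, h0, h1, c2, c3, c4, c5, c6, c7] at e
    push_cast at e
    linear_combination e / 112
  have c9 : c 9 = a ^ 9 * (8563103/1120 - 33863951/448 * a + 146680739/448 * a ^ 2 - 3233131/4 *
    a ^ 3 + 79364065/64 * a ^ 4 - 154618893/128 * a ^ 5 + 46621575/64 * a ^ 6 - 31795335/128 * a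
    ^ 7 + 4691115/128 * a ^ 8) := by
    have e := hn 6
    simp only [Finset.sum_range_succ, Finset.sum_range_zero, Nat.reduceAdd, Nat.reduceSub, zero_add,
      hr, hq, hA, h0, h1, c2, c3, c4, c5, c6, c7, c8] at e
    push_cast at e
    linear_combination e / 144
  have c10 : c 10 = a ^ 10 * (3272929/112 - 735432709/2240 * a + 7357755669/4480 * a ^ 2 -
    10718827603/2240 * a ^ 3 + 1428065353/160 * a ^ 4 - 176465289/16 * a ^ 5 + 2307754449/256 * a
    ^ 6 - 150219927/32 * a ^ 7 + 90382149/64 * a ^ 8 - 47849373/256 * a ^ 9) := by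
    have e := hn 7
    simp only [Finset.sum_range_succ, Finset.sum_range_zero, Nat.reduceAdd, Nat.reduceSub, zero_add,
      hr, hq, hA, h0, h1, c2, c3, c4, c5, c6, c7, c8, c9] at e
    push_cast at e
    linear_combination e / 180
  have c11 : c 11 = a ^ 11 * (635159557/5600 - 3197336823/2240 * a + 18143312469/2240 * a ^ 2 -
    121928028157/4480 * a ^ 3 + 7658309451/128 * a ^ 4 - 57437459079/640 * a ^ 5 + 371540169/4 *
    a ^ 6 - 4186990197/64 * a ^ 7 + 3838099707/128 * a ^ 8 - 2066222925/256 * a ^ 9 +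
    247946751/256 * a ^ 10) := by
    have e := hn 8
    simp only [Finset.sum_range_succ, Finset.sum_range_zero, Nat.reduceAdd, Nat.reduceSub, zero_add,
      hr, hq, hA, h0, h1, c2, c3, c4, c5, c6, c7, c8, c9, c10] at e
    push_cast at e
    linear_combination e / 220
  have c12 : c 12 = a ^ 12 * (2496658021/5600 - 139167607683/22400 * a + 353354615393/8960 * a ^
    2 - 19221283653/128 * a ^ 3 + 194742331147/512 * a ^ 4 - 214963495123/320 * a ^ 5 +
    539504615013/640 * a ^ 6 - 96098385825/128 * a ^ 7 + 29738304765/64 * a ^ 8 - 97387973865/512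
    * a ^ 9 + 23720239179/512 * a ^ 10 - 5206881771/1024 * a ^ 11) := by
    have e := hn 9
    simp only [Finset.sum_range_succ, Finset.sum_range_zero, Nat.reduceAdd, Nat.reduceSub, zero_add,
      hr, hq, hA, h0, h1, c2, c3, c4, c5, c6, c7, c8, c9, c10, c11] at e
    push_cast at e
    linear_combination e / 264
  exact ⟨c2, c3, c4, c5, c6, c7, c8, c9, c10, c11, c12⟩

lemma coeff_zero_eqSeries : coeff 0 eqSeries = 0 := by
  rw [← evalAt_zero_right]
  exact eqFun_zero

lemma coeff_one_eqSeries : coeff 1 eqSeries = eqFun' 0 := by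
  rw [eqFun', evalAt_zero_right, coeff_derivative]
  simp

lemma eqSeries_ode_expanded :
    C 2 * d⁄dX ℝ (d⁄dX ℝ eqSeries)
      + (C 2 * eqSeries - eqSeries * eqSeries) * d⁄dX ℝ (d⁄dX ℝ eqSeries) =
    C 8 * (d⁄dX ℝ eqSeries * d⁄dX ℝ eqSeries)
      - C 2 * (eqSeries * (d⁄dX ℝ eqSeries * d⁄dX ℝ eqSeries))
      - C 6 * (d⁄dX ℝ eqSeries * d⁄dX ℝ eqSeries * d⁄dX ℝ eqSeries)
      + C 6 * (X * (d⁄dX ℝ eqSeries * d⁄dX ℝ eqSeries * d⁄dX ℝ eqSeries)) := by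
  have h := eqSeries_ode
  rw [map_one] at h
  linear_combination h

/-- The decimal is the exact sum of the first 110 tabulated coefficients of φ'. Their rounding
contributes at most 110 · 110 · 6 / 10^30, and the geometric bound from index 110 on controls the
tail. -/
lemma abs_phi'_one_sub_le :
    |phi' (1 : ℝ) - 6196708440980893590102979775206 / 10 ^ 30| ≤ 1 / 10 ^ 23 := by
  have hs := ((convergesOn_phiSeries ℝ).derivative.hasSum (z := 1) (by norm_num)).summable
  have hsplit : phi' (1 : ℝ) = ∑ k ∈ Finset.range 110, coeff k (d⁄dX ℝ (phiSeries ℝ)) * 1 ^ k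
      + ∑' j, coeff (j + 110) (d⁄dX ℝ (phiSeries ℝ)) * 1 ^ (j + 110) :=
    (hs.sum_add_tsum_nat_add 110).symm
  have hg : HasSum (fun j : ℕ => 9 / 100 * (3 / 5) ^ 111 *
      ((j : ℝ) * (3 / 5 : ℝ) ^ j + 111 * (3 / 5) ^ j))
      (9 / 100 * (3 / 5) ^ 111 * (3 / 5 / (1 - 3 / 5) ^ 2 + 111 * (1 - 3 / 5)⁻¹)) :=
    ((hasSum_coe_mul_geometric_of_norm_lt_one (by rw [Real.norm_eq_abs, abs_of_pos] <;> norm_num)).add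
      ((hasSum_geometric_of_lt_one (by norm_num) (by norm_num)).mul_left _)).mul_left _
  have key : ∀ k, k < 112 → ((phiApprox k + 6) * 100 * 5 ^ k ≤ 9 * 3 ^ k * 10 ^ 30) →
      phiCoeff k ≤ 9 / 100 * (3 / 5) ^ k := by
    intro k hk h
    have h1 := (abs_le.1 (abs_phiCoeff_sub_phiApprox_le k hk)).2
    have h2 : ((phiApprox k : ℚ) + 6) * 100 * 5 ^ k ≤ 9 * 3 ^ k * 10 ^ 30 := by exact_mod_cast h
    rw [div_pow, ← mul_div_assoc, le_div_iff₀ (by positivity)]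
    have h3 : 10 ^ 30 * phiCoeff k ≤ phiApprox k + 6 := by linarith
    have h4 := mul_le_mul_of_nonneg_right h3 (by positivity : (0 : ℚ) ≤ 5 ^ k)
    linarith
  have htail : ∀ j, ((phiCoeff (110 + j) : ℚ) : ℝ) ≤ 9 / 100 * (3 / 5) ^ (110 + j) := by
    intro j
    have := (Rat.cast_le (K := ℝ)).2 (phiCoeff_le_geometric (N := 110) (by norm_num)
      (key 110 (by norm_num) (by decide +kernel)) (key 111 (by norm_num) (by decide +kernel)) j)
    push_cast at this
    exact this
  have h1 : ‖∑' j, coeff (j + 110) (d⁄dX ℝ (phiSeries ℝ)) * 1 ^ (j + 110)‖ ≤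
      9 / 100 * (3 / 5) ^ 111 * (3 / 5 / (1 - 3 / 5) ^ 2 + 111 * (1 - 3 / 5)⁻¹) := by
    refine tsum_of_norm_bounded hg fun j => ?_
    have hj := htail (j + 1)
    have h0 : (0 : ℝ) ≤ ((phiCoeff (j + 110 + 1) : ℚ) : ℝ) := by
      exact_mod_cast phiCoeff_nonneg _
    rw [one_pow, mul_one, coeff_derivative, coeff_phiSeries, Real.norm_eq_abs,
      abs_of_nonneg (mul_nonneg h0 (by positivity))]
    rw [show 110 + (j + 1) = j + 110 + 1 by ring] at hj
    push_cast
    calc ((phiCoeff (j + 110 + 1) : ℚ) : ℝ) * (j + 110 + 1)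
        ≤ 9 / 100 * (3 / 5) ^ (j + 110 + 1) * (j + 110 + 1) := by gcongr
      _ = _ := by rw [show j + 110 + 1 = j + 111 by ring, pow_add]; ring
  have h2 : |∑ k ∈ Finset.range 110, coeff k (d⁄dX ℝ (phiSeries ℝ)) * 1 ^ k
      - (∑ k ∈ Finset.range 110, (phiDerivApprox k : ℝ)) / 10 ^ 30| ≤
      ∑ k ∈ Finset.range 110, 110 * (6 / 10 ^ 30 : ℝ) := by
    rw [Finset.sum_div, ← Finset.sum_sub_distrib, ← Real.norm_eq_abs]
    refine norm_sum_le_of_le _ fun k hk => ?_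
    have hk' := Finset.mem_range.1 hk
    have h := (Rat.cast_le (K := ℝ)).2 (abs_phiCoeff_sub_phiApprox_le (k + 1) (by omega))
    push_cast at h
    have e : coeff k (d⁄dX ℝ (phiSeries ℝ)) * 1 ^ k - (phiDerivApprox k : ℝ) / 10 ^ 30 =
        ((k : ℝ) + 1) * ((10 ^ 30 * ((phiCoeff (k + 1) : ℚ) : ℝ) - phiApprox (k + 1)) / 10 ^ 30) := by
      rw [coeff_derivative, coeff_phiSeries, phiDerivApprox]
      push_cast
      ring
    have hk2 : (k : ℝ) + 1 ≤ 110 := by exact_mod_cast hk'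
    rw [e, norm_mul, norm_div, Real.norm_eq_abs, Real.norm_eq_abs, Real.norm_eq_abs,
      abs_of_nonneg (by positivity : (0 : ℝ) ≤ (k : ℝ) + 1),
      abs_of_pos (by positivity : (0 : ℝ) < 10 ^ 30)]
    gcongr
  have h3 : ∑ k ∈ Finset.range 110, phiDerivApprox k = 6196708440980893590102979775206 := by
    decide +kernel
  have h4 : ∑ k ∈ Finset.range 110, (phiDerivApprox k : ℝ) = 6196708440980893590102979775206 := by
    exact_mod_cast h3
  rw [h4, Finset.sum_const, Finset.card_range] at h2
  rw [Real.norm_eq_abs] at h1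
  rw [hsplit]
  have h5 : (110 : ℕ) • (110 * (6 / 10 ^ 30 : ℝ)) +
      9 / 100 * (3 / 5) ^ 111 * (3 / 5 / (1 - 3 / 5) ^ 2 + 111 * (1 - 3 / 5)⁻¹) ≤ 1 / 10 ^ 23 := by
    norm_num
  refine le_trans ?_ h5
  rw [add_sub_right_comm]
  exact (abs_add_le _ _).trans (add_le_add h2 h1)

/-- c₁ = F'(0) = (9/2) / φ'(1), by differentiating the defining relation at x = 0. -/
lemma abs_coeff_one_sub_le :
    |coeff 1 eqSeries - (7261919844800190304321278 / 10 ^ 25 : ℝ)| ≤ 1 / 10 ^ 22 := by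
  have h1 := eqFun'_zero
  have h2 := abs_le.1 abs_phi'_one_sub_le
  rw [← coeff_one_eqSeries] at h1
  generalize coeff 1 eqSeries = a at *
  generalize phi' (1 : ℝ) = D at *
  have hD : (6 : ℝ) < D := by
    have := h2.1
    norm_num at this ⊢
    linarith
  rw [abs_le]
  constructor
  · by_contra hcon
    push Not at hcon
    have : a < (7261919844800190304321278 / 10 ^ 25 : ℝ) - 1 / 10 ^ 22 := by linarith
    have h3 := mul_lt_mul_of_pos_right this (by linarith : (0 : ℝ) < D)
    rw [h1] at h3
    norm_num at h3 h2
    linarith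
  · by_contra hcon
    push Not at hcon
    have : (7261919844800190304321278 / 10 ^ 25 : ℝ) + 1 / 10 ^ 22 < a := by linarith
    have h3 := mul_lt_mul_of_pos_right this (by linarith : (0 : ℝ) < D)
    rw [h1] at h3
    norm_num at h3 h2
    linarith

lemma coeff_derivative_derivative (f : PowerSeries ℝ) (m : ℕ) :
    coeff m (d⁄dX ℝ (d⁄dX ℝ f)) = ((m : ℝ) + 2) * ((m : ℝ) + 1) * coeff (m + 2) f := by
  rw [coeff_derivative, coeff_derivative]
  push_cast
  ring

-- The polynomials in c₁ alternate in sign with coefficients up to nearly 10^9, so many digits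
-- cancel; this is why c₁ is needed to about 22 digits for a final precision of 10^(-7).
set_option maxHeartbeats 2000000 in
lemma eqSeries_coeff_bounds :
    |coeff 1 eqSeries - 0.726193| ≤ 2 / 10 ^ 6 ∧
    |coeff 2 eqSeries - 0.480269| ≤ 2 / 10 ^ 6 ∧
    |coeff 3 eqSeries - 0.181628| ≤ 2 / 10 ^ 6 ∧
    |coeff 4 eqSeries - 0.0444137| ≤ 3 / 10 ^ 7 ∧
    |coeff 5 eqSeries - 0.0509559| ≤ 3 / 10 ^ 7 ∧
    |coeff 6 eqSeries - 0.0648413| ≤ 3 / 10 ^ 7 ∧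
    |coeff 7 eqSeries - 0.0363864| ≤ 3 / 10 ^ 7 ∧
    |coeff 8 eqSeries - 0.0123602| ≤ 3 / 10 ^ 7 ∧
    |coeff 9 eqSeries - 0.0178371| ≤ 3 / 10 ^ 7 ∧
    |coeff 10 eqSeries - 0.0244243| ≤ 3 / 10 ^ 7 ∧
    |coeff 11 eqSeries - 0.0144697| ≤ 3 / 10 ^ 7 ∧
    |coeff 12 eqSeries - 0.00535718| ≤ 1 / 10 ^ 7 := by
  have ha := abs_coeff_one_sub_le
  obtain ⟨a, ha1⟩ : ∃ a, coeff 1 eqSeries = a := ⟨_, rfl⟩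
  obtain ⟨c2, c3, c4, c5, c6, c7, c8, c9, c10, c11, c12⟩ :=
    coeff_polynomials (c := fun n => coeff n eqSeries)
      (q := fun n => coeff n (d⁄dX ℝ eqSeries * d⁄dX ℝ eqSeries))
      (A := fun n => coeff n (eqSeries * eqSeries))
      (r := fun n => coeff n (d⁄dX ℝ eqSeries * d⁄dX ℝ eqSeries * d⁄dX ℝ eqSeries)) a
      coeff_zero_eqSeries ha1
      (fun n => by
        rw [coeff_mul, Finset.Nat.sum_antidiagonal_eq_sum_range_succ_mk])
      (fun n => by
        rw [coeff_mul, Finset.Nat.sum_antidiagonal_eq_sum_range_succ_mk]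
        refine Finset.sum_congr rfl fun i _ => ?_
        simp only [coeff_derivative]
        ring)
      (fun n => by
        rw [coeff_mul, Finset.Nat.sum_antidiagonal_eq_sum_range_succ_mk]
        refine Finset.sum_congr rfl fun i _ => ?_
        simp only [coeff_derivative]
        ring)
      (by
        have h := congrArg (coeff 0) eqSeries_ode_expanded
        have h00 := coeff_zero_eqSeries
        rw [coeff_zero_eq_constantCoeff_apply] at h00
        have e1 : coeff 0 ((C 2 * eqSeries - eqSeries * eqSeries) * d⁄dX ℝ (d⁄dX ℝ eqSeries)) = 0 := by
          simp [h00]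
        have e2 : coeff 0 (eqSeries * (d⁄dX ℝ eqSeries * d⁄dX ℝ eqSeries)) = 0 := by
          simp [h00]
        rw [map_add, e1, map_add, map_sub, map_sub] at h
        simp only [coeff_C_mul, coeff_zero_X_mul, e2] at h
        rw [coeff_derivative, coeff_derivative] at h
        push_cast at h
        linear_combination h)
      (fun n => by
        have h := congrArg (coeff (n + 1)) eqSeries_ode_expanded
        simp only [map_add, map_sub, coeff_C_mul, coeff_succ_X_mul] at h
        rw [coeff_mul, Finset.Nat.sum_antidiagonal_eq_sum_range_succ_mk,
          coeff_mul _ eqSeries, Finset.Nat.sum_antidiagonal_eq_sum_range_succ_mk] at h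
        have h3 : ((n : ℝ) + 3) * (n + 2) * coeff (n + 3) eqSeries =
            coeff (n + 1) (d⁄dX ℝ (d⁄dX ℝ eqSeries)) := by
          rw [coeff_derivative_derivative]
          push_cast
          ring
        rw [h3]
        refine Eq.trans (congrArg₂ _ rfl (Finset.sum_congr rfl fun i _ => ?_)) h
        rw [coeff_derivative_derivative, map_sub, coeff_C_mul])
  change coeff 2 eqSeries = _ at c2
  rw [ha1] at ha
  have hb : 0 ≤ a ∧ a ≤ 1 := by
    have := abs_le.1 ha
    norm_num at this ⊢
    constructor <;> linarith
  -- The degree of the polynomial for c₁₂ is 12 + 11 = 23. On [0, 1] the j-th power is j-Lipschitz.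
  -- Each coefficient then becomes a linear expression in separately enclosed powers of a.
  have hp : ∀ j : ℕ, j ≤ 23 → |a ^ j - ((7261919844800190304321278 / 10 ^ 25 : ℝ)) ^ j| ≤ 1 / 10 ^ 20 := by
    intro j hj
    have h := norm_pow_sub_pow_le (z := a) (c := (7261919844800190304321278 / 10 ^ 25 : ℝ)) (r := 1)
      (by rw [Real.norm_eq_abs, abs_of_nonneg hb.1]; exact hb.2)
      (by rw [Real.norm_eq_abs, abs_of_nonneg] <;> norm_num) j
    rw [one_pow, mul_one, Real.norm_eq_abs, Real.norm_eq_abs] at h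
    have hj' : (j : ℝ) ≤ 23 := by exact_mod_cast hj
    calc _ ≤ _ := h
      _ ≤ 23 * (1 / 10 ^ 22) := by gcongr
      _ ≤ _ := by norm_num
  have hl : ∀ j : ℕ, j ≤ 23 → (7261919844800190304321278 / 10 ^ 25 : ℝ) ^ j - 1 / 10 ^ 20 ≤ a ^ j := fun j hj => by
    have := (abs_le.1 (hp j hj)).1
    linarith
  have hu : ∀ j : ℕ, j ≤ 23 → a ^ j ≤ (7261919844800190304321278 / 10 ^ 25 : ℝ) ^ j + 1 / 10 ^ 20 := fun j hj => by
    have := (abs_le.1 (hp j hj)).2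
    linarith
  refine ⟨?_, ?_, ?_, ?_, ?_, ?_, ?_, ?_, ?_, ?_, ?_, ?_⟩
  · rw [ha1, abs_le]
    have := abs_le.1 ha
    norm_num at this ⊢
    constructor <;> linarith
  · rw [c2, abs_le]
    constructor <;> linarith [hl 2 (by norm_num), hu 2 (by norm_num), hl 3 (by norm_num), hu 3 (by norm_num)]
  · rw [c3, abs_le]
    constructor <;> linarith [hl 3 (by norm_num), hu 3 (by norm_num), hl 4 (by norm_num), hu 4 (by norm_num),
      hl 5 (by norm_num), hu 5 (by norm_num)]
  · rw [c4, abs_le]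
    constructor <;> linarith [hl 4 (by norm_num), hu 4 (by norm_num), hl 5 (by norm_num), hu 5 (by norm_num),
      hl 6 (by norm_num), hu 6 (by norm_num), hl 7 (by norm_num), hu 7 (by norm_num)]
  · rw [c5, abs_le]
    constructor <;> linarith [hl 5 (by norm_num), hu 5 (by norm_num), hl 6 (by norm_num), hu 6 (by norm_num),
      hl 7 (by norm_num), hu 7 (by norm_num), hl 8 (by norm_num), hu 8 (by norm_num),
      hl 9 (by norm_num), hu 9 (by norm_num)]
  · rw [c6, abs_le]
    constructor <;> linarith [hl 6 (by norm_num), hu 6 (by norm_num), hl 7 (by norm_num), hu 7 (by norm_num),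
      hl 8 (by norm_num), hu 8 (by norm_num), hl 9 (by norm_num), hu 9 (by norm_num),
      hl 10 (by norm_num), hu 10 (by norm_num), hl 11 (by norm_num),
      hu 11 (by norm_num)]
  · rw [c7, abs_le]
    constructor <;> linarith [hl 7 (by norm_num), hu 7 (by norm_num), hl 8 (by norm_num), hu 8 (by norm_num),
      hl 9 (by norm_num), hu 9 (by norm_num), hl 10 (by norm_num), hu 10 (by norm_num),
      hl 11 (by norm_num), hu 11 (by norm_num), hl 12 (by norm_num),
      hu 12 (by norm_num), hl 13 (by norm_num), hu 13 (by norm_num)]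
  · rw [c8, abs_le]
    constructor <;> linarith [hl 8 (by norm_num), hu 8 (by norm_num), hl 9 (by norm_num), hu 9 (by norm_num),
      hl 10 (by norm_num), hu 10 (by norm_num), hl 11 (by norm_num),
      hu 11 (by norm_num), hl 12 (by norm_num), hu 12 (by norm_num),
      hl 13 (by norm_num), hu 13 (by norm_num), hl 14 (by norm_num),
      hu 14 (by norm_num), hl 15 (by norm_num), hu 15 (by norm_num)]
  · rw [c9, abs_le]
    constructor <;> linarith [hl 9 (by norm_num), hu 9 (by norm_num), hl 10 (by norm_num), hu 10 (by norm_num),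
      hl 11 (by norm_num), hu 11 (by norm_num), hl 12 (by norm_num),
      hu 12 (by norm_num), hl 13 (by norm_num), hu 13 (by norm_num),
      hl 14 (by norm_num), hu 14 (by norm_num), hl 15 (by norm_num),
      hu 15 (by norm_num), hl 16 (by norm_num), hu 16 (by norm_num),
      hl 17 (by norm_num), hu 17 (by norm_num)]
  · rw [c10, abs_le]
    constructor <;> linarith [hl 10 (by norm_num), hu 10 (by norm_num), hl 11 (by norm_num),
      hu 11 (by norm_num), hl 12 (by norm_num), hu 12 (by norm_num),
      hl 13 (by norm_num), hu 13 (by norm_num), hl 14 (by norm_num),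
      hu 14 (by norm_num), hl 15 (by norm_num), hu 15 (by norm_num),
      hl 16 (by norm_num), hu 16 (by norm_num), hl 17 (by norm_num),
      hu 17 (by norm_num), hl 18 (by norm_num), hu 18 (by norm_num),
      hl 19 (by norm_num), hu 19 (by norm_num)]
  · rw [c11, abs_le]
    constructor <;> linarith [hl 11 (by norm_num), hu 11 (by norm_num), hl 12 (by norm_num),
      hu 12 (by norm_num), hl 13 (by norm_num), hu 13 (by norm_num),
      hl 14 (by norm_num), hu 14 (by norm_num), hl 15 (by norm_num),
      hu 15 (by norm_num), hl 16 (by norm_num), hu 16 (by norm_num),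
      hl 17 (by norm_num), hu 17 (by norm_num), hl 18 (by norm_num),
      hu 18 (by norm_num), hl 19 (by norm_num), hu 19 (by norm_num),
      hl 20 (by norm_num), hu 20 (by norm_num), hl 21 (by norm_num),
      hu 21 (by norm_num)]
  · rw [c12, abs_le]
    constructor <;> linarith [hl 12 (by norm_num), hu 12 (by norm_num), hl 13 (by norm_num),
      hu 13 (by norm_num), hl 14 (by norm_num), hu 14 (by norm_num),
      hl 15 (by norm_num), hu 15 (by norm_num), hl 16 (by norm_num),
      hu 16 (by norm_num), hl 17 (by norm_num), hu 17 (by norm_num),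
      hl 18 (by norm_num), hu 18 (by norm_num), hl 19 (by norm_num),
      hu 19 (by norm_num), hl 20 (by norm_num), hu 20 (by norm_num),
      hl 21 (by norm_num), hu 21 (by norm_num), hl 22 (by norm_num),
      hu 22 (by norm_num), hl 23 (by norm_num), hu 23 (by norm_num)]

end Coefficients

/-! ### The payoff of a pure guess as a function of x. -/

section Indifference

/-- The equilibrium distribution function. -/
noncomputable def eqCdf (x : ℝ) : ℝ := eqFun (max 0 (min x (7 / 9)))

lemma clamp_mem (x : ℝ) : max 0 (min x (7 / 9)) ∈ Set.Icc (0 : ℝ) (7 / 9) :=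
  ⟨le_max_left _ _, max_le (by norm_num) (min_le_right _ _)⟩

lemma eqCdf_of_mem {x : ℝ} (hx : x ∈ Set.Icc (0 : ℝ) (7 / 9)) : eqCdf x = eqFun x := by
  rw [eqCdf, min_eq_left hx.2, max_eq_right hx.1]

lemma eqCdf_of_nonpos {x : ℝ} (hx : x ≤ 0) : eqCdf x = 0 := by
  rw [eqCdf, min_eq_left (hx.trans (by norm_num)), max_eq_left hx, eqFun_zero]

lemma eqCdf_of_ge {x : ℝ} (hx : 7 / 9 ≤ x) : eqCdf x = 1 := by
  rw [eqCdf, min_eq_right hx, max_eq_right (by norm_num), eqFun_seven_ninths]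

lemma monotone_eqCdf : Monotone eqCdf := fun x y hxy =>
  monotoneOn_eqFun (clamp_mem x) (clamp_mem y) (max_le_max le_rfl (min_le_min hxy le_rfl))

lemma continuous_eqCdf : Continuous eqCdf := by
  have h : ContinuousOn eqFun (Set.Icc 0 (7 / 9)) := fun x hx =>
    (hasDerivAt_eqFun (abs_lt_of_mem_Icc hx)).continuousAt.continuousWithinAt
  exact h.comp_continuous (by fun_prop) clamp_mem

lemma hasDerivAt_eqCdf {x : ℝ} (hx : x ∈ Set.Ioo (0 : ℝ) (7 / 9)) :
    HasDerivAt eqCdf (eqFun' x) x :=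
  (hasDerivAt_eqFun (abs_lt_of_mem_Icc (Set.Ioo_subset_Icc_self hx))).congr_of_eventuallyEq
    (Filter.eventually_of_mem (isOpen_Ioo.mem_nhds hx) fun _ ht =>
      eqCdf_of_mem (Set.Ioo_subset_Icc_self ht))

lemma eq_right_of_hasDerivAt_zero {g : ℝ → ℝ} {a b : ℝ} (hg : ContinuousOn g (Set.Icc a b))
    (hd : ∀ x ∈ Set.Ioo a b, HasDerivAt g 0 x) {x : ℝ} (hx : x ∈ Set.Icc a b) : g x = g b := by
  rcases hx.2.eq_or_lt with rfl | hlt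
  · rfl
  obtain ⟨c, _, hc⟩ := exists_hasDerivAt_eq_slope g (fun _ => 0) hlt
    (hg.mono (Set.Icc_subset_Icc_left hx.1)) fun t ht => hd t ⟨hx.1.trans_lt ht.1, ht.2⟩
  rw [eq_comm, div_eq_zero_iff] at hc
  rcases hc with hc | hc <;> linarith

/-- The integral of the survival function. -/
noncomputable def survival (x : ℝ) : ℝ := ∫ t in (0 : ℝ)..x, (1 - eqCdf t)

/-- The integral of the squared survival function. -/
noncomputable def survivalSq (x : ℝ) : ℝ := ∫ t in (0 : ℝ)..x, (1 - eqCdf t) ^ 2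

lemma hasDerivAt_survival (x : ℝ) : HasDerivAt survival (1 - eqCdf x) x :=
  ((continuous_const.sub continuous_eqCdf).integral_hasStrictDerivAt 0 x).hasDerivAt

lemma hasDerivAt_survivalSq (x : ℝ) : HasDerivAt survivalSq ((1 - eqCdf x) ^ 2) x :=
  (((continuous_const.sub continuous_eqCdf).pow 2).integral_hasStrictDerivAt 0 x).hasDerivAt

lemma continuous_survival : Continuous survival :=
  continuous_iff_continuousAt.2 fun x => (hasDerivAt_survival x).continuousAt

lemma continuous_survivalSq : Continuous survivalSq :=
  continuous_iff_continuousAt.2 fun x => (hasDerivAt_survivalSq x).continuousAt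

lemma survival_of_ge {x : ℝ} (hx : 7 / 9 ≤ x) : survival x = survival (7 / 9) := by
  have h : ∫ t in (7 / 9 : ℝ)..x, (1 - eqCdf t) = 0 := by
    rw [intervalIntegral.integral_congr (g := fun _ => (0 : ℝ)), intervalIntegral.integral_zero]
    intro t ht
    rw [Set.uIcc_of_le hx] at ht
    simp [eqCdf_of_ge ht.1]
  have hc : Continuous fun t => 1 - eqCdf t := continuous_const.sub continuous_eqCdf
  have := intervalIntegral.integral_add_adjacent_intervals
    (hc.intervalIntegrable (μ := volume) 0 (7 / 9)) (hc.intervalIntegrable (7 / 9) x)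
  rw [h, add_zero] at this
  exact this.symm

lemma survivalSq_of_ge {x : ℝ} (hx : 7 / 9 ≤ x) : survivalSq x = survivalSq (7 / 9) := by
  have h : ∫ t in (7 / 9 : ℝ)..x, (1 - eqCdf t) ^ 2 = 0 := by
    rw [intervalIntegral.integral_congr (g := fun _ => (0 : ℝ)), intervalIntegral.integral_zero]
    intro t ht
    rw [Set.uIcc_of_le hx] at ht
    simp [eqCdf_of_ge ht.1]
  have hc : Continuous fun t => (1 - eqCdf t) ^ 2 := (continuous_const.sub continuous_eqCdf).pow 2
  have := intervalIntegral.integral_add_adjacent_intervals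
    (hc.intervalIntegrable (μ := volume) 0 (7 / 9)) (hc.intervalIntegrable (7 / 9) x)
  rw [h, add_zero] at this
  exact this.symm

/-- The integrated form of the equilibrium condition. -/
lemma six_mul_eqFun'_mul {x : ℝ} (hx : x ∈ Set.Icc (0 : ℝ) (7 / 9)) :
    6 * eqFun' x * (survival 1 - survival x + eqFun x * (1 - x)) =
      2 + 2 * eqFun x - eqFun x * eqFun x := by
  -- Solved for the integral term, the condition differentiates to the second-order equation, so g
  -- is constant. It vanishes at 7/9 because F = 1 and F' = 9/4 there, which is the initial
  -- condition φ'(0) = 2 φ(0).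
  let g : ℝ → ℝ := fun x => survival 1 - survival x + eqFun x * (1 - x)
    - (2 + 2 * eqFun x - eqFun x * eqFun x) / (6 * eqFun' x)
  have hd : ∀ x ∈ Set.Icc (0 : ℝ) (7 / 9), HasDerivAt g 0 x := by
    intro x hx
    have hx' := abs_lt_of_mem_Icc hx
    have h1 := hasDerivAt_eqFun hx'
    have h2 := hasDerivAt_eqFun' hx'
    have hp := eqFun'_pos hx'
    have ode := eqFun_ode hx'
    have h3 := (((hasDerivAt_survival x).const_sub (survival 1)).add
      (h1.mul ((hasDerivAt_id x).const_sub 1))).sub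
      ((((h1.const_mul 2).const_add 2).sub (h1.mul h1)).div (h2.const_mul 6) (by positivity))
    refine HasDerivAt.congr_deriv h3 ?_
    simp only [id, Pi.sub_apply, Pi.mul_apply]
    rw [eqCdf_of_mem hx]
    field_simp
    linear_combination ode
  have h0 := eq_right_of_hasDerivAt_zero (g := g)
    (fun t ht => (hd t ht).continuousAt.continuousWithinAt)
    (fun t ht => hd t (Set.Ioo_subset_Icc_self ht)) hx
  have hp := eqFun'_pos (abs_lt_of_mem_Icc hx)
  have h1 : g (7 / 9) = 0 := by
    simp only [g, eqFun_seven_ninths, eqFun'_seven_ninths,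
      survival_of_ge (x := 1) (by norm_num)]
    norm_num
  rw [h1] at h0
  simp only [g, sub_eq_zero] at h0
  rw [h0]
  field_simp

/-- The expected payoff of the guess `x` in terms of the opponents' distribution function. -/
noncomputable def guessPayoff (x : ℝ) : ℝ :=
  3 * (survivalSq 1 - survivalSq x + 2 * eqCdf x * (survival 1 - survival x)
    + eqCdf x ^ 2 * (1 - x)) - 1 + survivalSq x

/-- The derivative of the payoff simplifies to 6 F' T - (2 + 2F - F²), with T the bracket in
`six_mul_eqFun'_mul`, and so it vanishes. -/
lemma guessPayoff_eq_right {x : ℝ} (hx : x ∈ Set.Icc (0 : ℝ) (7 / 9)) :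
    guessPayoff x = guessPayoff (7 / 9) := by
  refine eq_right_of_hasDerivAt_zero ?_ (fun t ht => ?_) hx
  · have := continuous_survival
    have := continuous_survivalSq
    have := continuous_eqCdf
    unfold guessPayoff
    fun_prop
  · have ht' := Set.Ioo_subset_Icc_self ht
    have h1 := hasDerivAt_eqCdf ht
    have h2 := hasDerivAt_survival t
    have h3 := hasDerivAt_survivalSq t
    have h4 := ((((((h3.const_sub (survivalSq 1)).add ((h1.const_mul 2).mul
      (h2.const_sub (survival 1)))).add ((h1.pow 2).mul
      ((hasDerivAt_id t).const_sub 1))).const_mul 3).sub_const 1).add h3)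
    refine HasDerivAt.congr_deriv h4 ?_
    have key := six_mul_eqFun'_mul ht'
    simp only [id, Pi.pow_apply]
    push_cast
    rw [eqCdf_of_mem ht']
    linear_combination key

/-- Writing s for this integral, the payoff is 3s - 1 at 0 and 3 · (2/9) - 1 + s at 7/9. Equating
the two determines s, and the common payoff is 0. -/
lemma survivalSq_seven_ninths : survivalSq (7 / 9) = 1 / 3 := by
  have h := guessPayoff_eq_right (x := 0) (by constructor <;> norm_num)
  have h0 : survival 0 = 0 := by simp [survival]
  have h0' : survivalSq 0 = 0 := by simp [survivalSq]
  simp only [guessPayoff, h0, h0', eqCdf_of_nonpos le_rfl, eqCdf_of_ge le_rfl,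
    survival_of_ge (x := 1) (by norm_num), survivalSq_of_ge (x := 1) (by norm_num)] at h
  linarith

lemma guessPayoff_of_ge {x : ℝ} (hx : 7 / 9 ≤ x) : guessPayoff x = 3 * (7 / 9 - x) := by
  simp only [guessPayoff, eqCdf_of_ge hx, survival_of_ge hx, survivalSq_of_ge hx,
    survival_of_ge (x := 1) (by norm_num), survivalSq_of_ge (x := 1) (by norm_num),
    survivalSq_seven_ninths]
  ring

lemma guessPayoff_eq_zero {x : ℝ} (hx : x ∈ Set.Icc (0 : ℝ) (7 / 9)) : guessPayoff x = 0 := by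
  rw [guessPayoff_eq_right hx, guessPayoff_of_ge le_rfl]
  ring

lemma guessPayoff_nonpos {x : ℝ} (hx : 0 ≤ x) : guessPayoff x ≤ 0 := by
  rcases le_total x (7 / 9) with h | h
  · exact (guessPayoff_eq_zero ⟨hx, h⟩).le
  · rw [guessPayoff_of_ge h]
    linarith

/-- Split the integral at r = x and expand (1 - F(r) + F(x))² in powers of 1 - F(r). -/
lemma integral_eq_guessPayoff {x : ℝ} (hx : x ∈ Set.Icc (0 : ℝ) 1) :
    ∫ r in Set.Icc (0 : ℝ) 1, (3 * (if x < r then 1 else 0) * (1 - (eqCdf r - eqCdf x)) ^ 2 - 1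
      + (if r ≤ x then 1 else 0) * (1 - eqCdf r) ^ 2) = guessPayoff x := by
  have hc : Continuous fun t => 1 - eqCdf t := continuous_const.sub continuous_eqCdf
  have hc2 : Continuous fun t => (1 - eqCdf t) ^ 2 := hc.pow 2
  have hl : ∀ t ∈ Set.uIoc 0 x, 3 * (if x < t then (1 : ℝ) else 0) *
      (1 - (eqCdf t - eqCdf x)) ^ 2 - 1 + (if t ≤ x then 1 else 0) * (1 - eqCdf t) ^ 2 =
      -1 + (1 - eqCdf t) ^ 2 := by
    intro t ht
    rw [Set.uIoc_of_le hx.1] at ht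
    rw [if_neg (not_lt.2 ht.2), if_pos ht.2]
    ring
  have hr : ∀ t ∈ Set.uIoc x 1, 3 * (if x < t then (1 : ℝ) else 0) *
      (1 - (eqCdf t - eqCdf x)) ^ 2 - 1 + (if t ≤ x then 1 else 0) * (1 - eqCdf t) ^ 2 =
      3 * (1 - eqCdf t) ^ 2 + 6 * eqCdf x * (1 - eqCdf t) + (3 * eqCdf x ^ 2 - 1) := by
    intro t ht
    rw [Set.uIoc_of_le hx.2] at ht
    rw [if_pos ht.1, if_neg (not_le.2 ht.1)]
    ring
  have cl : Continuous fun t => -1 + (1 - eqCdf t) ^ 2 := by fun_prop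
  have cr : Continuous fun t => 3 * (1 - eqCdf t) ^ 2 + 6 * eqCdf x * (1 - eqCdf t)
      + (3 * eqCdf x ^ 2 - 1) := by fun_prop
  rw [integral_Icc_eq_integral_Ioc, ← intervalIntegral.integral_of_le zero_le_one,
    ← intervalIntegral.integral_add_adjacent_intervals (b := x)
      ((cl.intervalIntegrable 0 x).congr fun t ht => (hl t ht).symm)
      ((cr.intervalIntegrable x 1).congr fun t ht => (hr t ht).symm),
    intervalIntegral.integral_congr_ae (Filter.Eventually.of_forall hl),
    intervalIntegral.integral_congr_ae (Filter.Eventually.of_forall hr),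
    intervalIntegral.integral_add (by simp) (hc2.intervalIntegrable _ _),
    intervalIntegral.integral_add (Continuous.intervalIntegrable (by fun_prop) _ _) (by simp),
    intervalIntegral.integral_add (Continuous.intervalIntegrable (by fun_prop) _ _)
      (Continuous.intervalIntegrable (by fun_prop) _ _),
    intervalIntegral.integral_const_mul, intervalIntegral.integral_const_mul,
    intervalIntegral.integral_const, intervalIntegral.integral_const]
  have e1 : ∫ t in x..1, (1 - eqCdf t) = survival 1 - survival x :=
    (intervalIntegral.integral_interval_sub_left (hc.intervalIntegrable 0 1)
      (hc.intervalIntegrable 0 x)).symm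
  have e2 : ∫ t in x..1, (1 - eqCdf t) ^ 2 = survivalSq 1 - survivalSq x :=
    (intervalIntegral.integral_interval_sub_left (hc2.intervalIntegrable 0 1)
      (hc2.intervalIntegrable 0 x)).symm
  rw [e1, e2]
  change (x - 0) • (-1 : ℝ) + survivalSq x + _ = _
  simp only [guessPayoff, smul_eq_mul]
  ring

end Indifference

/-! ### Reduction of the three-person expected payoff to an integral over the deviator's guess. -/

section Game

/-- The payoff of the guess `x` against opponents who guess `v`, none of them `x`. -/
noncomputable def duelPayoff (x : ℝ) (v : Fin 2 → ℝ) (r : ℝ) : ℝ :=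
  3 * (if x < r then 1 else 0) * (∏ j, if x ≤ v j ∧ v j < r then 0 else 1) - 1
    + (if r ≤ x then 1 else 0) * ∏ j, if r ≤ v j then 1 else 0

lemma mem_winners {n : ℕ} {y : Fin n → ℝ} {r : ℝ} {i : Fin n} :
    i ∈ winners y r ↔ y i < r ∧ ∀ j, y j < r → y j ≤ y i := by
  simp [winners]

lemma winners_eq_empty_iff {n : ℕ} {y : Fin n → ℝ} {r : ℝ} :
    winners y r = ∅ ↔ ∀ j, r ≤ y j := by
  constructor
  · intro h j
    by_contra! hj
    obtain ⟨k, hk, hmax⟩ := Finset.exists_max_image (Finset.univ.filter fun k => y k < r) y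
      ⟨j, by simpa using hj⟩
    have : k ∈ winners y r :=
      mem_winners.2 ⟨by simpa using hk, fun l hl => hmax l (by simpa using hl)⟩
    simp [h] at this
  · intro h
    refine Finset.eq_empty_of_forall_notMem fun j hj => ?_
    exact (h j).not_gt (mem_winners.1 hj).1

/-- If no opponent shares the guess of player i, then player i can win only alone and receives 3 -
1. The last term of `duelPayoff` restores the payoff 0 when every guess is at least r. -/
lemma targetPayoff_eq_duelPayoff {y : Fin 3 → ℝ} {i : Fin 3}
    (hy : ∀ j, y (i.succAbove j) ≠ y i) (r : ℝ) :
    targetPayoff y r i = duelPayoff (y i) (fun j => y (i.succAbove j)) r := by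
  rcases lt_or_ge (y i) r with hr | hr
  · have hne : winners y r ≠ ∅ := fun h => (winners_eq_empty_iff.1 h i).not_gt hr
    rw [targetPayoff, if_neg hne, duelPayoff, if_pos hr, if_neg (not_le.2 hr)]
    by_cases hw : i ∈ winners y r
    · have hlt : ∀ j, y (i.succAbove j) < r → y (i.succAbove j) < y i := fun j hj =>
        lt_of_le_of_ne ((mem_winners.1 hw).2 _ hj) (hy j)
      have hone : winners y r = {i} := by
        refine Finset.eq_singleton_iff_unique_mem.2 ⟨hw, fun k hk => ?_⟩
        by_contra hki
        obtain ⟨j, rfl⟩ := Fin.exists_succAbove_eq hki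
        have hk' := mem_winners.1 hk
        exact (hlt j hk'.1).not_ge (hk'.2 i hr)
      rw [if_pos hw, hone, Finset.prod_eq_one fun j _ =>
        if_neg fun h => (hlt j h.2).not_ge h.1]
      norm_num
    · obtain ⟨j, hj⟩ : ∃ j, y i ≤ y (i.succAbove j) ∧ y (i.succAbove j) < r := by
        by_contra! h
        refine hw (mem_winners.2 ⟨hr, fun k hk => ?_⟩)
        by_cases hki : k = i
        · rw [hki]
        · obtain ⟨j, rfl⟩ := Fin.exists_succAbove_eq hki
          by_contra! hlt
          exact (h j hlt.le).not_gt hk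
      rw [if_neg hw, Finset.prod_eq_zero (Finset.mem_univ j) (by exact if_pos hj)]
      norm_num
  · rw [duelPayoff, if_neg (not_lt.2 hr), if_pos hr]
    have hw : i ∉ winners y r := fun h => hr.not_gt (mem_winners.1 h).1
    rw [targetPayoff, if_neg hw]
    by_cases h : ∀ j : Fin 2, r ≤ y (i.succAbove j)
    · rw [if_pos (winners_eq_empty_iff.2 ((Fin.forall_iff_succAbove i).2 ⟨hr, h⟩)),
        Finset.prod_eq_one fun j _ => if_pos (h j)]
      norm_num
    · rw [if_neg fun he => h ((Fin.forall_iff_succAbove i).1 (winners_eq_empty_iff.1 he)).2]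
      push Not at h
      obtain ⟨j, hj⟩ := h
      have h0 : (∏ j, if r ≤ y (i.succAbove j) then (1 : ℝ) else 0) = 0 :=
        Finset.prod_eq_zero (Finset.mem_univ j) (if_neg (not_le.2 hj))
      rw [h0]
      norm_num

lemma measurable_duelPayoff :
    Measurable fun p : (ℝ × (Fin 2 → ℝ)) × ℝ => duelPayoff p.1.1 p.1.2 p.2 := by
  have h1 : MeasurableSet {p : (ℝ × (Fin 2 → ℝ)) × ℝ | p.1.1 < p.2} :=
    measurableSet_lt (by fun_prop) (by fun_prop)
  have h2 : MeasurableSet {p : (ℝ × (Fin 2 → ℝ)) × ℝ | p.2 ≤ p.1.1} :=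
    measurableSet_le (by fun_prop) (by fun_prop)
  have h3 (j : Fin 2) :
      MeasurableSet {p : (ℝ × (Fin 2 → ℝ)) × ℝ | p.1.1 ≤ p.1.2 j ∧ p.1.2 j < p.2} :=
    MeasurableSet.inter (s₁ := {p : (ℝ × (Fin 2 → ℝ)) × ℝ | p.1.1 ≤ p.1.2 j})
      (s₂ := {p : (ℝ × (Fin 2 → ℝ)) × ℝ | p.1.2 j < p.2})
      (measurableSet_le (by fun_prop) (by fun_prop))
      (measurableSet_lt (by fun_prop) (by fun_prop))
  have h4 (j : Fin 2) : MeasurableSet {p : (ℝ × (Fin 2 → ℝ)) × ℝ | p.2 ≤ p.1.2 j} :=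
    measurableSet_le (by fun_prop) (by fun_prop)
  unfold duelPayoff
  refine Measurable.add (Measurable.sub (Measurable.mul (Measurable.mul measurable_const
    (Measurable.ite h1 measurable_const measurable_const)) ?_) measurable_const)
    (Measurable.mul (Measurable.ite h2 measurable_const measurable_const) ?_)
  · exact Finset.measurable_prod _ fun j _ => Measurable.ite (h3 j) measurable_const measurable_const
  · exact Finset.measurable_prod _ fun j _ => Measurable.ite (h4 j) measurable_const measurable_const

lemma norm_duelPayoff_le (x : ℝ) (v : Fin 2 → ℝ) (r : ℝ) : ‖duelPayoff x v r‖ ≤ 5 := by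
  rw [duelPayoff, Fin.prod_univ_two, Fin.prod_univ_two, Real.norm_eq_abs, abs_le]
  constructor <;> split_ifs <;> norm_num

variable {μ : Measure ℝ}

lemma integral_ite_one_zero {s : Set ℝ} [DecidablePred (· ∈ s)] (hs : MeasurableSet s) :
    ∫ t, (if t ∈ s then (1 : ℝ) else 0) ∂μ = μ.real s := by
  have : (fun t => if t ∈ s then (1 : ℝ) else 0) = s.indicator 1 := by
    ext t
    by_cases h : t ∈ s <;> simp [h]
  rw [this, integral_indicator_one hs]

variable [IsProbabilityMeasure μ]

lemma integral_ite_zero_one {s : Set ℝ} [DecidablePred (· ∈ s)] (hs : MeasurableSet s) :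
    ∫ t, (if t ∈ s then (0 : ℝ) else 1) ∂μ = 1 - μ.real s := by
  have : (fun t => if t ∈ s then (0 : ℝ) else 1) = sᶜ.indicator 1 := by
    ext t
    by_cases h : t ∈ s <;> simp [h]
  rw [this, integral_indicator_one hs.compl, probReal_compl_eq_one_sub hs]

lemma integrable_prod_comp {f : ℝ → ℝ} (hf : Measurable f) (hb : ∀ t, ‖f t‖ ≤ 1) :
    Integrable (fun v : Fin 2 → ℝ => ∏ j, f (v j)) (Measure.pi fun _ => μ) :=
  Integrable.fintype_prod fun _ =>
    Integrable.of_bound hf.aestronglyMeasurable 1 (Filter.Eventually.of_forall hb)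

/-- The two opponents are independent and identically distributed, so each product over them
integrates to a square. -/
lemma integral_duelPayoff (x r : ℝ) :
    ∫ v, duelPayoff x v r ∂(Measure.pi fun _ : Fin 2 => μ) =
      3 * (if x < r then 1 else 0) * (1 - μ.real (Set.Ico x r)) ^ 2 - 1
        + (if r ≤ x then 1 else 0) * μ.real (Set.Ici r) ^ 2 := by
  classical
  have i1 := integrable_prod_comp (μ := μ) (f := fun t => if t ∈ Set.Ico x r then 0 else 1)
    (Measurable.ite measurableSet_Ico measurable_const measurable_const)
    (fun t => by split_ifs <;> simp)
  have i2 := integrable_prod_comp (μ := μ) (f := fun t => if t ∈ Set.Ici r then 1 else 0)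
    (Measurable.ite measurableSet_Ici measurable_const measurable_const)
    (fun t => by split_ifs <;> simp)
  have e1 := integral_fintype_prod_eq_pow (ι := Fin 2)
    (fun t => if t ∈ Set.Ico x r then (0 : ℝ) else 1) (μ := μ)
  have e2 := integral_fintype_prod_eq_pow (ι := Fin 2)
    (fun t => if t ∈ Set.Ici r then (1 : ℝ) else 0) (μ := μ)
  rw [integral_ite_zero_one measurableSet_Ico, Fintype.card_fin] at e1
  rw [integral_ite_one_zero measurableSet_Ici, Fintype.card_fin] at e2
  rw [← e1, ← e2]
  simp only [Set.mem_Ico, Set.mem_Ici] at i1 i2 ⊢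
  unfold duelPayoff
  rw [integral_add (by exact (i1.const_mul _).sub (integrable_const _)) (i2.const_mul _),
    integral_sub (i1.const_mul _) (integrable_const _), integral_const_mul, integral_const_mul]
  simp

/-- Separate coordinate i from the others, discard ties, and exchange the integral over the target
with that over the opponents' guesses. -/
lemma expectedPayoff_update [NullSingletonClass μ] (ν : Measure ℝ) [IsProbabilityMeasure ν]
    (i : Fin 3) :
    expectedPayoff (Function.update (fun _ : Fin 3 => μ) i ν) i =
      ∫ x, (∫ r in Set.Icc (0 : ℝ) 1, (3 * (if x < r then 1 else 0) *
        (1 - μ.real (Set.Ico x r)) ^ 2 - 1 + (if r ≤ x then 1 else 0) *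
          μ.real (Set.Ici r) ^ 2)) ∂ν := by
  let σ := Function.update (fun _ : Fin 3 => μ) i ν
  have hσi : σ i = ν := by simp [σ]
  have hσ : (fun j => σ (i.succAbove j)) = fun _ => μ := by
    ext1 j
    simp [σ, Fin.succAbove_ne]
  have : ∀ j, IsProbabilityMeasure (σ j) := by
    intro j
    by_cases h : j = i
    · rw [h, hσi]; infer_instance
    · simp only [σ, Function.update_of_ne h]; infer_instance
  have mp := measurePreserving_piFinSuccAbove σ i
  rw [hσi, hσ] at mp
  let Q := Measure.pi fun _ : Fin 2 => μ
  let D : ℝ × (Fin 2 → ℝ) → ℝ := fun p => ∫ r in Set.Icc (0 : ℝ) 1, duelPayoff p.1 p.2 r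
  have hD : ∀ᵐ y ∂(Measure.pi σ), payoff y i = D (MeasurableEquiv.piFinSuccAbove (fun _ => ℝ) i y) := by
    -- For each fixed guess x of the deviator a tie is a hyperplane, null because μ has no atoms; ν
    -- itself may have atoms.
    have hne : ∀ᵐ p ∂(ν.prod Q), ∀ j, p.2 j ≠ p.1 := by
      rw [ae_all_iff]
      intro j
      have hm : MeasurableSet {p : ℝ × (Fin 2 → ℝ) | p.2 j ≠ p.1} :=
        (measurableSet_eq_fun (by fun_prop) (by fun_prop)).compl
      rw [Measure.ae_prod_iff_ae_ae hm]
      refine Filter.Eventually.of_forall fun x => ?_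
      rw [ae_iff]
      simpa using Measure.pi_hyperplane (μ := fun _ : Fin 2 => μ) j x
    filter_upwards [mp.quasiMeasurePreserving.ae hne] with y hy
    exact integral_congr_ae (Filter.Eventually.of_forall fun r =>
      targetPayoff_eq_duelPayoff hy r)
  have hDi : Integrable D (ν.prod Q) := by
    refine Integrable.of_bound
      (measurable_duelPayoff.stronglyMeasurable.integral_prod_right).aestronglyMeasurable 5
      (Filter.Eventually.of_forall fun p => ?_)
    refine (norm_integral_le_of_norm_le_const
      (Filter.Eventually.of_forall fun r => norm_duelPayoff_le p.1 p.2 r)).trans ?_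
    simp
  calc expectedPayoff σ i
      = ∫ y, D (MeasurableEquiv.piFinSuccAbove (fun _ => ℝ) i y) ∂(Measure.pi σ) :=
        integral_congr_ae hD
    _ = ∫ p, D p ∂(ν.prod Q) := mp.integral_comp' D
    _ = ∫ x, ∫ v, D (x, v) ∂Q ∂ν := integral_prod D hDi
    _ = _ := by
        apply integral_congr_ae
        filter_upwards with x
        simp only [D]
        rw [integral_integral_swap (f := fun v r => duelPayoff x v r)]
        · simp only [Q, integral_duelPayoff]
        · refine Integrable.of_bound (Measurable.aestronglyMeasurable ?_) 5
            (Filter.Eventually.of_forall fun p => norm_duelPayoff_le x p.1 p.2)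
          exact measurable_duelPayoff.comp (by fun_prop :
            Measurable fun p : (Fin 2 → ℝ) × ℝ => ((x, p.1), p.2))

end Game

/-! ### The equilibrium measure and its optimality. -/

section Equilibrium

/-- The equilibrium distribution function as a Stieltjes function. -/
noncomputable def eqStieltjes : StieltjesFunction ℝ where
  toFun := eqCdf
  mono' := monotone_eqCdf
  right_continuous' _ := continuous_eqCdf.continuousWithinAt

/-- The equilibrium strategy. -/
noncomputable def eqMeasure : Measure ℝ := eqStieltjes.measure

lemma eqStieltjes_apply (x : ℝ) : eqStieltjes x = eqCdf x := rfl

lemma tendsto_eqStieltjes_atBot : Filter.Tendsto eqStieltjes Filter.atBot (nhds 0) :=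
  tendsto_const_nhds.congr' ((Filter.eventually_le_atBot 0).mono fun _ hx =>
    (eqCdf_of_nonpos hx).symm)

lemma tendsto_eqStieltjes_atTop : Filter.Tendsto eqStieltjes Filter.atTop (nhds 1) :=
  tendsto_const_nhds.congr' ((Filter.eventually_ge_atTop (7 / 9)).mono fun _ hx =>
    (eqCdf_of_ge hx).symm)

instance : IsProbabilityMeasure eqMeasure :=
  eqStieltjes.isProbabilityMeasure tendsto_eqStieltjes_atBot tendsto_eqStieltjes_atTop

lemma leftLim_eqStieltjes (x : ℝ) : Function.leftLim eqStieltjes x = eqCdf x :=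
  (continuous_eqCdf.continuousAt (x := x)).continuousWithinAt.leftLim_eq

instance : NullSingletonClass eqMeasure :=
  ⟨fun x => by
    rw [eqMeasure, StieltjesFunction.measure_singleton, leftLim_eqStieltjes, eqStieltjes_apply,
      sub_self, ENNReal.ofReal_zero]⟩

lemma cdf_eqMeasure (x : ℝ) : cdf eqMeasure x = eqCdf x := by
  rw [eqMeasure, cdf_measure_stieltjesFunction _ tendsto_eqStieltjes_atBot
    tendsto_eqStieltjes_atTop, eqStieltjes_apply]

lemma eqCdf_le_one (x : ℝ) : eqCdf x ≤ 1 := cdf_eqMeasure x ▸ cdf_le_one eqMeasure x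

lemma eqMeasure_real_Ico {x r : ℝ} (h : x ≤ r) :
    eqMeasure.real (Set.Ico x r) = eqCdf r - eqCdf x := by
  rw [Measure.real, eqMeasure, StieltjesFunction.measure_Ico, leftLim_eqStieltjes,
    leftLim_eqStieltjes, ENNReal.toReal_ofReal (sub_nonneg.2 (monotone_eqCdf h))]

lemma eqMeasure_real_Ici (r : ℝ) : eqMeasure.real (Set.Ici r) = 1 - eqCdf r := by
  rw [Measure.real, eqMeasure, StieltjesFunction.measure_Ici _ tendsto_eqStieltjes_atTop,
    leftLim_eqStieltjes, ENNReal.toReal_ofReal (sub_nonneg.2 (eqCdf_le_one r))]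

lemma eqMeasure_compl_Icc : eqMeasure (Set.Icc (0 : ℝ) (7 / 9))ᶜ = 0 := by
  rw [prob_compl_eq_zero_iff measurableSet_Icc, eqMeasure, StieltjesFunction.measure_Icc,
    leftLim_eqStieltjes, eqStieltjes_apply, eqCdf_of_nonpos le_rfl, eqCdf_of_ge le_rfl]
  simp

lemma expectedPayoff_eqMeasure {ν : Measure ℝ} (hν : IsMixedStrategy ν) (i : Fin 3) :
    expectedPayoff (Function.update (fun _ : Fin 3 => eqMeasure) i ν) i =
      ∫ x, guessPayoff x ∂ν := by
  have := hν.1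
  rw [expectedPayoff_update]
  have hx : ∀ᵐ x ∂ν, x ∈ Set.Icc (0 : ℝ) 1 := hν.2
  apply integral_congr_ae
  filter_upwards [hx] with x hx
  rw [← integral_eq_guessPayoff hx]
  apply integral_congr_ae
  filter_upwards with r
  rw [eqMeasure_real_Ici]
  rcases lt_or_ge x r with h | h
  · rw [eqMeasure_real_Ico h.le]
  · simp [not_lt.2 h]

lemma isMixedStrategy_eqMeasure : IsMixedStrategy eqMeasure :=
  ⟨inferInstance, measure_mono_null (Set.compl_subset_compl.2
    (Set.Icc_subset_Icc_right (by norm_num))) eqMeasure_compl_Icc⟩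

lemma expectedPayoff_dirac (i : Fin 3) {x : ℝ} (hx : x ∈ Set.Icc (0 : ℝ) (7 / 9)) :
    expectedPayoff (Function.update (fun _ : Fin 3 => eqMeasure) i (Measure.dirac x)) i = 0 := by
  have hx1 : x ∈ Set.Icc (0 : ℝ) 1 := Set.Icc_subset_Icc_right (by norm_num) hx
  rw [expectedPayoff_eqMeasure ⟨inferInstance, by simp [hx1.1, hx1.2]⟩, integral_dirac,
    guessPayoff_eq_zero hx]

/-- Any mixed strategy earns the average of the pure payoffs, which are nonpositive on [0, 1]. The
equilibrium strategy lives where they are zero. -/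
lemma isOptimal_eqMeasure : IsOptimal 3 eqMeasure := by
  refine ⟨isMixedStrategy_eqMeasure, fun i ν hν => ?_⟩
  have h0 : expectedPayoff (fun _ : Fin 3 => eqMeasure) i = 0 := by
    have h := expectedPayoff_eqMeasure isMixedStrategy_eqMeasure i
    rw [Function.update_eq_self] at h
    rw [h]
    have hx : ∀ᵐ x ∂eqMeasure, x ∈ Set.Icc (0 : ℝ) (7 / 9) := eqMeasure_compl_Icc
    exact integral_eq_zero_of_ae (hx.mono fun x hx => guessPayoff_eq_zero hx)
  rw [h0, expectedPayoff_eqMeasure hν]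
  have hx : ∀ᵐ x ∂ν, x ∈ Set.Icc (0 : ℝ) 1 := hν.2
  exact integral_nonpos_of_ae (hx.mono fun x hx => guessPayoff_nonpos hx.1)

lemma deriv_cdf_eqMeasure {x : ℝ} (hx : x ∈ Set.Ioo (0 : ℝ) (7 / 9)) :
    deriv (cdf eqMeasure) x = eqFun' x := by
  rw [show (cdf eqMeasure : ℝ → ℝ) = eqCdf from funext cdf_eqMeasure]
  exact (hasDerivAt_eqCdf hx).deriv

lemma deriv_deriv_cdf_eqMeasure {x : ℝ} (hx : x ∈ Set.Ioo (0 : ℝ) (7 / 9)) :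
    deriv (deriv (cdf eqMeasure)) x = eqFun'' x :=
  ((hasDerivAt_eqFun' (abs_lt_of_mem_Icc (Set.Ioo_subset_Icc_self hx))).congr_of_eventuallyEq
    (Filter.eventually_of_mem (isOpen_Ioo.mem_nhds hx) fun _ ht => deriv_cdf_eqMeasure ht)).deriv

end Equilibrium

end PriceIsRight

theorem theorem2p3 :
    ∃ (μ : Measure ℝ) (c : ℕ → ℝ),
      -- `μ` is an optimal strategy of the three person game, concentrated on `[0,7/9]`
      PriceIsRight.IsOptimal 3 μ ∧
      μ (Set.Icc (0 : ℝ) (7 / 9))ᶜ = 0 ∧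
      -- its cumulative distribution function `F` is a power series on `[0,7/9]`
      (∀ x ∈ Set.Icc (0 : ℝ) (7 / 9), HasSum (fun k : ℕ => c k * x ^ k) (cdf μ x)) ∧
      cdf μ 0 = 0 ∧ cdf μ (7 / 9) = 1 ∧
      -- the coefficients
      c 0 = 0 ∧
      |c 1 - 0.726193| ≤ 2 / 10 ^ 6 ∧
      |c 2 - 0.480269| ≤ 2 / 10 ^ 6 ∧
      |c 3 - 0.181628| ≤ 2 / 10 ^ 6 ∧
      |c 4 - 0.0444137| ≤ 3 / 10 ^ 7 ∧
      |c 5 - 0.0509559| ≤ 3 / 10 ^ 7 ∧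
      |c 6 - 0.0648413| ≤ 3 / 10 ^ 7 ∧
      |c 7 - 0.0363864| ≤ 3 / 10 ^ 7 ∧
      |c 8 - 0.0123602| ≤ 3 / 10 ^ 7 ∧
      |c 9 - 0.0178371| ≤ 3 / 10 ^ 7 ∧
      |c 10 - 0.0244243| ≤ 3 / 10 ^ 7 ∧
      |c 11 - 0.0144697| ≤ 3 / 10 ^ 7 ∧
      |c 12 - 0.00535718| ≤ 1 / 10 ^ 7 ∧
      -- the equilibrium condition: every guess in `[0,7/9]` earns `0` against two opponents using `F`
      (∀ i : Fin 3, ∀ x ∈ Set.Icc (0 : ℝ) (7 / 9),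
        PriceIsRight.expectedPayoff
          (Function.update (fun _ : Fin 3 => μ) i (Measure.dirac x)) i = 0) ∧
      -- the second-order differential equation
      (∀ x ∈ Set.Ioo (0 : ℝ) (7 / 9),
        8 * deriv (cdf μ) x ^ 2 - 2 * cdf μ x * deriv (cdf μ) x ^ 2
          - 6 * deriv (cdf μ) x ^ 3 + 6 * x * deriv (cdf μ) x ^ 3
          - 2 * deriv (deriv (cdf μ)) x - 2 * cdf μ x * deriv (deriv (cdf μ)) x
          + cdf μ x ^ 2 * deriv (deriv (cdf μ)) x = 0) := by
  open PriceIsRight in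
  refine ⟨eqMeasure, fun k => PowerSeries.coeff k eqSeries, isOptimal_eqMeasure,
    eqMeasure_compl_Icc, fun x hx => ?_, ?_, ?_, coeff_zero_eqSeries, ?_⟩
  · rw [cdf_eqMeasure, eqCdf_of_mem hx]
    exact convergesOn_eqSeries.hasSum (abs_lt_of_mem_Icc hx)
  · rw [cdf_eqMeasure, eqCdf_of_nonpos le_rfl]
  · rw [cdf_eqMeasure, eqCdf_of_ge le_rfl]
  · obtain ⟨b1, b2, b3, b4, b5, b6, b7, b8, b9, b10, b11, b12⟩ := eqSeries_coeff_bounds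
    refine ⟨b1, b2, b3, b4, b5, b6, b7, b8, b9, b10, b11, b12,
      fun i x hx => expectedPayoff_dirac i hx, fun x hx => ?_⟩
    have hx' := Set.Ioo_subset_Icc_self hx
    rw [deriv_deriv_cdf_eqMeasure hx, deriv_cdf_eqMeasure hx, cdf_eqMeasure, eqCdf_of_mem hx']
    linear_combination -eqFun_ode (abs_lt_of_mem_Icc hx')
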